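/- Let $k\geqslant 2$ be an integer and let $F(z)\in\mathbb{C}[[z]]$ be a $k$-Mahler function, i.e. $F$ satisfies $$a_0(z)F(z)+a_1(z)F(z^k)+\cdots+a_d(z)F(z^{k^d})=0$$ for some $d\geqslant 1$ and polynomials $a_0,\ldots,a_d\in\mathbb{C}[z]$, not all zero. (Such an $F$ converges near $0$ and extends to a meromorphic function on the open unit disc, again denoted $F$.) Suppose that the eigenvalue $\lambda_F$ of $F$ exists: for some Mahler equation of $F$ as above, the characteristic polynomial $a_0(1)\lambda^d+a_1(1)\lambda^{d-1}+\cdots+a_d(1)$ is not zero and has the nonzero complex number $\lambda_F$ as a root, and, as $z\to1^-$ along the reals, $$F(z)=\frac{C_F(z)}{(1-z)^{\log_k\lambda_F}}(1+o(1)),$$ where $\log_k$ is the principal value of the base-$k$ logarithm and $C_F$ is a complex-valued real-analytic function on $(0,1)$, bounded away from $0$ and $\infty$, with $C_F(z)=C_F(z^k)$. Suppose that $k$ and $\lambda_F$ are multiplicatively independent, i.e. $k^m\lambda_F^n=1$ with $m,n\in\mathbb{Z}$ only for $m=n=0$. Let $G$ be a $D$-finite function, analytic at some point $z_0$ of the open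 unit disc at which $F$ is also analytic; that is, near $z_0$, $G$ satisfies a homogeneous linear differential equation with polynomial coefficients, not all zero. Suppose that $G$ is transcendental over $\mathbb{C}(z)$. Let $\zeta$ be the Riemann zeta function. Then $$\operatorname{trdeg}_{\mathbb{C}(z)}\mathbb{C}(z)(F(z),G(z),\zeta(z))=3,$$ where the functions are regarded as (Laurent expansions of) germs at $z_0$. -/

import Mathlib

open Filter Topology Asymptotics

noncomputable section

/-- Rational functions as Laurent series in the variable `X`: Mathlib's standard embedding. -/
instance ratFuncAlgebraLaurent : Algebra (RatFunc ℂ) (LaurentSeries ℂ) :=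
  RatFunc.liftAlgebra ℂ (LaurentSeries ℂ)

/-- The Taylor series of `f` at `z₀`, as a power series in the local variable `X = z - z₀`. -/
def taylorSeriesAt (f : ℂ → ℂ) (z₀ : ℂ) : PowerSeries ℂ :=
  PowerSeries.mk fun n => iteratedDeriv n f z₀ / (n.factorial : ℂ)

/-- The germ at `z₀` of a function `f` analytic at `z₀`, as an element of the field of formal
Laurent series in `X = z - z₀`. In this field, `ℂ(z) = ℂ(z - z₀)` is the image of
`RatFunc ℂ`. -/
def germAt (f : ℂ → ℂ) (z₀ : ℂ) : LaurentSeries ℂ :=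
  ((taylorSeriesAt f z₀ : PowerSeries ℂ) : LaurentSeries ℂ)

/-- The functional equation
`a₀(z) F(z) + a₁(z) F(z ^ k) + ⋯ + a_d(z) F(z ^ (k ^ d)) = 0` with `d ≥ 1`. -/
def MahlerEquation (k d : ℕ) (a : ℕ → Polynomial ℂ) (F : PowerSeries ℂ) : Prop :=
  1 ≤ d ∧
    ∑ i ∈ Finset.range (d + 1),
      (a i : PowerSeries ℂ) * F.subst ((PowerSeries.X : PowerSeries ℂ) ^ (k ^ i)) = 0

/-- `F` is a `k`-Mahler function: it satisfies some nontrivial Mahler equation. -/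
def IsMahler (k : ℕ) (F : PowerSeries ℂ) : Prop :=
  ∃ (d : ℕ) (a : ℕ → Polynomial ℂ), (∃ i ≤ d, a i ≠ 0) ∧ MahlerEquation k d a F

/-- The characteristic polynomial `a₀(1) λ ^ d + a₁(1) λ ^ (d - 1) + ⋯ + a_d(1)` of a Mahler
equation. -/
def mahlerCharPoly (d : ℕ) (a : ℕ → Polynomial ℂ) : Polynomial ℂ :=
  ∑ i ∈ Finset.range (d + 1), Polynomial.C ((a i).eval 1) * Polynomial.X ^ (d - i)

/-- `f` is the meromorphic function on the open unit disc given near `0` by the power series `F`.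
(A Mahler power series always converges near `0` and continues meromorphically to the
open unit disc, by its functional equation. If `F` converges in the unit disc, then its sum
is such an `f`.) -/
structure IsMeromorphicRealization (F : PowerSeries ℂ) (f : ℂ → ℂ) : Prop where
  meromorphicOn : MeromorphicOn f (Metric.ball 0 1)
  analyticAt_zero : AnalyticAt ℂ f 0
  taylor : taylorSeriesAt f 0 = F

/-- `l` is the eigenvalue `λ_F` of the `k`-Mahler function `F`, realized by `f` on the unit disc:
it is a nonzero root of the (nonzero) characteristic polynomial of a Mahler equation of `F`, and
as `t → 1⁻`, `f(t) = C(t) / (1 - t) ^ (log_k l) * (1 + o(1))`, where `C` is real-analytic on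
`(0, 1)`, bounded away from `0` and `∞` there, and `C(t) = C(t ^ k)`. Here `log_k` is the
principal value. The asymptotics determine `l`. -/
def IsMahlerEigenvalue (k : ℕ) (F : PowerSeries ℂ) (f : ℂ → ℂ) (l : ℂ) : Prop :=
  (∃ (d : ℕ) (a : ℕ → Polynomial ℂ), MahlerEquation k d a F ∧
      mahlerCharPoly d a ≠ 0 ∧ (mahlerCharPoly d a).IsRoot l) ∧
    l ≠ 0 ∧
    ∃ C : ℝ → ℂ,
      AnalyticOnNhd ℝ C (Set.Ioo 0 1) ∧
      (∃ c₁ c₂ : ℝ, 0 < c₁ ∧ ∀ t ∈ Set.Ioo (0 : ℝ) 1, c₁ ≤ ‖C t‖ ∧ ‖C t‖ ≤ c₂) ∧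
      (∀ t ∈ Set.Ioo (0 : ℝ) 1, C (t ^ k) = C t) ∧
      (fun t : ℝ => f (t : ℂ)) ~[𝓝[<] (1 : ℝ)]
        (fun t : ℝ => C t / ((1 - t : ℝ) : ℂ) ^ (Complex.log l / (Real.log (k : ℝ) : ℂ)))

/-- Two complex numbers are multiplicatively independent. -/
def MultIndep (x y : ℂ) : Prop :=
  ∀ m n : ℤ, x ^ m * y ^ n = 1 → m = 0 ∧ n = 0

/-- `G` is (the germ at `z₀` of) a `D`-finite function: it is analytic at `z₀` and satisfies there
a homogeneous linear differential equation with polynomial coefficients, not all zero. -/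
def IsDFiniteAt (G : ℂ → ℂ) (z₀ : ℂ) : Prop :=
  AnalyticAt ℂ G z₀ ∧
    ∃ (r : ℕ) (p : ℕ → Polynomial ℂ), p r ≠ 0 ∧
      ∀ᶠ z in 𝓝 z₀, ∑ i ∈ Finset.range (r + 1), (p i).eval z * iteratedDeriv i G z = 0

end

/-! The germs are shown to be independent in the order G, ζ, F. That G is transcendental is the
hypothesis.

ζ over ℂ(z, G): z, G and finitely many derivatives of G generate a ring of finite transcendence
degree over ℂ whose algebraic closure is stable under d/dz, so any function algebraic over it
satisfies an algebraic differential equation with constant coefficients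
(`not_algebraicIndependent_iterate_derivation`). But ζ, ζ', ζ'', … are algebraically independent
over ℂ. As Dirichlet series they are the arithmetic functions (-log n)^j, and for each prime p
multiplication by the p-adic valuation is a derivation of the convolution ring; these derivations
lower the degree of a relation (`sum_mul_logPow_eq_zero`).

F over ℂ(z, G, ζ): suppose F is algebraic. The coefficients of the relation continue along segments
to the unit circle, away from the finitely many singularities of the differential equation and the
pole of ζ, so F is algebraic over the analytic germs at all but finitely many boundary points
(`finite_not_algebraicAtBoundary`). The point 1 may be exceptional, but the Mahler equation carries
algebraicity from the radii to ξ, …, ξ^(k^(q-1)) to the radius to ξ^(k^q). Starting from a root of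
unity of k-power order which avoids the exceptional set, one reaches the radius to 1
(`algebraicLeft_of_finite`). There, at points close to exp(-k^(-n)), F grows like a constant times
λ^n, and an analytic coefficient with a zero of order e at 1 decays like k^(-en). The relation
becomes an exponential sum with bases λ^j k^(-e_j), distinct by multiplicative independence, and
such a sum cannot vanish for all large n (`not_algebraicLeft_of_isEquivalent`). -/

/-! ### Algebraic independence of the derivatives of ζ, through Dirichlet series. -/

/-- The arithmetic function `n ↦ (-log n) ^ j` for `n ≠ 0`. -/
noncomputable def logPowZeta (j : ℕ) : ArithmeticFunction ℂ :=
  ⟨fun n => if n = 0 then 0 else (-Real.log n : ℂ) ^ j, by simp⟩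

theorem logPowZeta_apply (j : ℕ) {n : ℕ} (hn : n ≠ 0) :
    logPowZeta j n = (-Real.log n : ℂ) ^ j := by
  simp [logPowZeta, hn]

/-- Pointwise multiplication by the `p`-adic valuation, as a derivation of the ring of arithmetic
functions. -/
noncomputable def factorizationDerivation (p : ℕ) :
    Derivation ℂ (ArithmeticFunction ℂ) (ArithmeticFunction ℂ) :=
  Derivation.mk'
    { toFun := fun f => ⟨fun n => (n.factorization p : ℂ) * f n, by simp⟩
      map_add' := fun f g => ArithmeticFunction.ext fun n => mul_add _ _ _
      map_smul' := fun c f => ArithmeticFunction.ext fun n => mul_left_comm _ _ _ }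
    (by
      intro f g
      ext n
      rw [smul_eq_mul, smul_eq_mul, mul_comm g]
      change (n.factorization p : ℂ) * (f * g) n = _
      simp only [ArithmeticFunction.add_apply, ArithmeticFunction.mul_apply, Finset.mul_sum]
      rw [← Finset.sum_add_distrib]
      refine Finset.sum_congr rfl fun x hx => ?_
      have h := Nat.mem_divisorsAntidiagonal.mp hx
      have h1 : x.1 ≠ 0 := by rintro h0; simp [h0] at h; omega
      have h2 : x.2 ≠ 0 := by rintro h0; simp [h0] at h; omega
      -- The Leibniz rule is the additivity of the valuation on products, term by term in the
      -- convolution.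
      rw [← h.1, Nat.factorization_mul h1 h2, Finsupp.add_apply, Nat.cast_add]
      change _ = f x.1 * ((x.2.factorization p : ℂ) * g x.2) +
        (x.1.factorization p : ℂ) * f x.1 * g x.2
      ring)

theorem factorizationDerivation_apply (p : ℕ) (f : ArithmeticFunction ℂ) (n : ℕ) :
    factorizationDerivation p f n = (n.factorization p : ℂ) * f n := rfl

theorem Derivation.map_aeval_mvPolynomial {R A ι : Type*} [CommRing R] [CommRing A] [Algebra R A]
    [Fintype ι] (D : Derivation R A A) (x : ι → A) (Q : MvPolynomial ι R) :
    D (MvPolynomial.aeval x Q) =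
      ∑ j, MvPolynomial.aeval x (MvPolynomial.pderiv j Q) * D (x j) := by
  classical
  induction Q using MvPolynomial.induction_on with
  | C c => simp
  | add p q hp hq => simp [hp, hq, add_mul, Finset.sum_add_distrib]
  | mul_X p i hp =>
    simp only [map_mul, MvPolynomial.aeval_X, Derivation.leibniz, smul_eq_mul, map_add,
      MvPolynomial.pderiv_X, hp, add_mul, Finset.sum_add_distrib, Finset.mul_sum]
    congr 1
    · rw [Finset.sum_eq_single i]
      · simp
      · intro b _ hb; simp [hb.symm]
      · simp
    · exact Finset.sum_congr rfl fun j _ => by ring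

/-- Let n be least with some `W j n` nonzero, and evaluate at `n * p`. The derived factor vanishes
at arguments prime to p, so only the factorisation (n, p) contributes, and the polynomial ∑ `W j n`
X^j has the root -log p. This holds for infinitely many p. -/
theorem sum_mul_logPow_eq_zero {N : ℕ} (W : Fin N → ArithmeticFunction ℂ)
    (h : ∀ p : ℕ, p.Prime →
      ∑ j, W j * factorizationDerivation p (logPowZeta j) = 0) : ∀ j, W j = 0 := by
  by_contra! hne
  obtain ⟨j₀, hj₀⟩ := hne
  have hex : ∃ n, ∃ j, W j n ≠ 0 := by
    by_contra! hall
    exact hj₀ (ArithmeticFunction.ext fun n => hall n j₀)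
  classical
  obtain ⟨n, ⟨j₁, hj₁⟩, hmin⟩ : ∃ n, (∃ j, W j n ≠ 0) ∧ ∀ m < n, ∀ j, W j m = 0 :=
    ⟨Nat.find hex, Nat.find_spec hex, fun m hm j => by
      simpa using fun h => Nat.find_min hex hm ⟨j, h⟩⟩
  have hn : n ≠ 0 := by rintro rfl; simp at hj₁
  have key : ∀ p : ℕ, p.Prime → ∑ j : Fin N, W j n * (-Real.log p : ℂ) ^ (j : ℕ) = 0 := by
    intro p hp
    have := congrArg (fun f : ArithmeticFunction ℂ => f (n * p)) (h p hp)
    rw [ArithmeticFunction.zero_apply] at this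
    rw [← this]
    have hs : ∀ (s : Finset (Fin N)) (f : Fin N → ArithmeticFunction ℂ) (m : ℕ),
        (∑ j ∈ s, f j) m = ∑ j ∈ s, f j m := by
      intro s f m
      induction s using Finset.induction_on with
      | empty => simp
      | insert a s ha ih => simp [Finset.sum_insert ha, ih]
    simp only [hs]
    refine Finset.sum_congr rfl fun j _ => ?_
    rw [ArithmeticFunction.mul_apply, Finset.sum_eq_single (n, p)]
    · rw [factorizationDerivation_apply, logPowZeta_apply _ hp.ne_zero, hp.factorization_self]
      simp
    · rintro ⟨a, b⟩ hab hne
      obtain ⟨hab, h0⟩ := Nat.mem_divisorsAntidiagonal.mp hab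
      simp only at hab ⊢
      by_cases ha : a < n
      · simp [hmin a ha j]
      · rw [factorizationDerivation_apply]
        by_cases hpb : p ∣ b
        · exfalso
          obtain ⟨c, rfl⟩ := hpb
          have hac : a * c = n := by
            have : p * (a * c) = p * n := by rw [← mul_assoc, mul_comm p a, mul_assoc, hab, mul_comm]
            exact Nat.eq_of_mul_eq_mul_left hp.pos this
          have hc : c ≠ 0 := by rintro rfl; simp at hac; exact hn hac.symm
          have : a ≤ n := by rw [← hac]; exact Nat.le_mul_of_pos_right _ (Nat.pos_of_ne_zero hc)
          have han : a = n := by omega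
          subst han
          have : c = 1 := by
            have := Nat.eq_of_mul_eq_mul_left (Nat.pos_of_ne_zero hn) (hac.trans (mul_one _).symm)
            exact this
          exact hne (by simp [this])
        · simp [Nat.factorization_eq_zero_of_not_dvd hpb]
    · intro hnot
      exact absurd (Nat.mem_divisorsAntidiagonal.mpr ⟨rfl, mul_ne_zero hn hp.ne_zero⟩) hnot
  set P : Polynomial ℂ := ∑ j : Fin N, Polynomial.C (W j n) * Polynomial.X ^ (j : ℕ) with hP
  have hP0 : P = 0 := by
    refine Polynomial.eq_zero_of_infinite_isRoot P
      (Set.Infinite.mono (s := (fun p : ℕ => (-Real.log p : ℂ)) '' {p | p.Prime}) ?_ ?_)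
    · rintro _ ⟨p, hp, rfl⟩
      simp only [Set.mem_ofPred_eq, Polynomial.IsRoot.def, hP, Polynomial.eval_finsetSum,
        Polynomial.eval_mul, Polynomial.eval_C, Polynomial.eval_pow, Polynomial.eval_X]
      exact key p hp
    · refine Nat.infinite_setOfPred_prime.image fun p hp q hq hpq => ?_
      have hp' : (0 : ℝ) < p := by exact_mod_cast (Nat.Prime.pos hp)
      have hq' : (0 : ℝ) < q := by exact_mod_cast (Nat.Prime.pos hq)
      exact_mod_cast Real.log_injOn_pos hp' hq' (by exact_mod_cast neg_injective hpq)
  have := congrArg (fun P : Polynomial ℂ => P.coeff j₁) hP0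
  simp only [hP, Polynomial.finsetSum_coeff, Polynomial.coeff_C_mul_X_pow,
    Polynomial.coeff_zero] at this
  rw [Finset.sum_eq_single j₁] at this
  · simp at this; exact hj₁ this
  · intro b _ hb
    rw [if_neg]
    exact fun h => hb (Fin.ext h.symm)
  · simp

theorem MvPolynomial.totalDegree_pderiv_lt {σ R : Type*} [CommRing R] (Q : MvPolynomial σ R)
    (hQ : Q.totalDegree ≠ 0) (j : σ) : (pderiv j Q).totalDegree < Q.totalDegree := by
  classical
  rw [MvPolynomial.totalDegree, Finset.sup_lt_iff (by simpa using Nat.pos_of_ne_zero hQ)]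
  intro m hm
  rw [MvPolynomial.mem_support_iff] at hm
  have h1 : Q.coeff (m + Finsupp.single j 1) ≠ 0 := by
    intro h
    apply hm
    rw [MvPolynomial.coeff_pderiv, h]
    simp
  have := MvPolynomial.le_totalDegree (MvPolynomial.mem_support_iff.mpr h1)
  rw [Finsupp.sum_add_index' (by simp) (by simp)] at this
  simp at this
  omega

theorem MvPolynomial.eq_C_of_pderiv_eq_zero {σ R : Type*} [CommRing R] [IsDomain R] [CharZero R]
    (Q : MvPolynomial σ R) (hQ : ∀ j, pderiv j Q = 0) : Q = C (Q.coeff 0) := by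
  classical
  ext m
  rw [MvPolynomial.coeff_C]
  split_ifs with h
  · rw [h]
  · obtain ⟨j, hj⟩ : ∃ j, m j ≠ 0 := by
      by_contra! h'
      exact h (Finsupp.ext fun j => (h' j).symm)
    have := congrArg (MvPolynomial.coeff (m - Finsupp.single j 1)) (hQ j)
    rw [MvPolynomial.coeff_pderiv, MvPolynomial.coeff_zero] at this
    have hm : m - Finsupp.single j 1 + Finsupp.single j 1 = m :=
      tsub_add_cancel_of_le (by simpa [Finsupp.single_le_iff] using Nat.one_le_iff_ne_zero.mpr hj)
    rw [hm] at this
    rcases mul_eq_zero.mp this with h0 | h0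
    · exact h0
    · exact absurd h0 (by norm_cast)

/-- Induction on the degree: by the chain rule, applying all the derivations to a relation Q shows
that each partial derivative of Q is again a relation, hence zero by induction. In characteristic
zero Q is then constant. -/
theorem algebraicIndependent_logPowZeta (N : ℕ) :
    AlgebraicIndependent ℂ (fun j : Fin N => logPowZeta j) := by
  rw [algebraicIndependent_iff]
  intro Q
  induction hd : Q.totalDegree using Nat.strong_induction_on generalizing Q with
  | _ d ih =>
    intro hQ
    have hC : ∀ c : ℂ, Q = MvPolynomial.C c → Q = 0 := by
      intro c hc
      rw [hc, MvPolynomial.algHom_C] at hQ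
      have := congrArg (fun f : ArithmeticFunction ℂ => f 1) hQ
      simp only [ArithmeticFunction.algebraMap_apply_one, ArithmeticFunction.zero_apply] at this
      simp at this
      simp [hc, this]
    by_cases h0 : Q.totalDegree = 0
    · exact hC _ (MvPolynomial.totalDegree_eq_zero_iff_eq_C.mp h0)
    · refine hC _ (MvPolynomial.eq_C_of_pderiv_eq_zero Q fun j => ?_)
      refine ih _ (hd ▸ Q.totalDegree_pderiv_lt h0 j) _ rfl ?_
      refine sum_mul_logPow_eq_zero
        (fun j => MvPolynomial.aeval (fun j : Fin N => logPowZeta j) (MvPolynomial.pderiv j Q))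
        (fun p _ => ?_) j
      rw [← Derivation.map_aeval_mvPolynomial, hQ, map_zero]

theorem LSeries_logPowZeta (j : ℕ) {s : ℂ} (hs : 1 < s.re) :
    LSeriesHasSum (logPowZeta j) s (iteratedDeriv j riemannZeta s) := by
  set z : ℕ → ℂ := fun n => ((ArithmeticFunction.zeta n : ℕ) : ℂ) with hzdef
  have hab : LSeries.abscissaOfAbsConv z < s.re := by
    refine lt_of_le_of_lt (LSeries.abscissaOfAbsConv_le_of_forall_lt_LSeriesSummable (x := 1) ?_)
      (by exact_mod_cast hs)
    intro y hy
    exact ArithmeticFunction.LSeriesSummable_zeta_iff.mpr (by simpa using hy)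
  have hlog : ∀ {n : ℕ}, n ≠ 0 →
      ((-1 : ℂ) ^ j • LSeries.logMul^[j] z : ℕ → ℂ) n = logPowZeta j n := by
    intro n hn
    have : (LSeries.logMul^[j] z) n = (Real.log n : ℂ) ^ j := by
      clear hab
      induction j with
      | zero => simp [hzdef, hn]
      | succ j ih => rw [Function.iterate_succ_apply', LSeries.logMul, ih, pow_succ',
          Complex.natCast_log]
    rw [logPowZeta_apply j hn, Pi.smul_apply, this, neg_pow (Real.log n : ℂ)]
    simp
  have hz : iteratedDeriv j (LSeries z) s = iteratedDeriv j riemannZeta s := by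
    refine Filter.EventuallyEq.iteratedDeriv_eq _ ?_
    filter_upwards [(isOpen_lt continuous_const Complex.continuous_re).mem_nhds hs] with w hw
    exact ArithmeticFunction.LSeries_zeta_eq_riemannZeta hw
  rw [← LSeriesHasSum_congr s _ hlog, ← hz, LSeries_iteratedDeriv j hab]
  have hsum : LSeriesSummable (LSeries.logMul^[j] z) s :=
    LSeriesSummable_of_abscissaOfAbsConv_lt_re (by rwa [LSeries.absicssaOfAbsConv_logPowMul])
  exact hsum.LSeriesHasSum.smul ((-1 : ℂ) ^ j)

theorem LSeries_aeval_logPowZeta {N : ℕ} (Q : MvPolynomial (Fin N) ℂ) {s : ℂ} (hs : 1 < s.re) :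
    LSeriesHasSum (MvPolynomial.aeval (fun j : Fin N => logPowZeta j) Q) s
      (MvPolynomial.aeval (fun j : Fin N => iteratedDeriv j riemannZeta s) Q) := by
  have hadd : ∀ f g : ArithmeticFunction ℂ, ((f + g : ArithmeticFunction ℂ) : ℕ → ℂ) = f + g :=
    fun f g => rfl
  induction Q using MvPolynomial.induction_on with
  | C c =>
    have h1 : LSeriesHasSum (1 : ArithmeticFunction ℂ) s 1 := by
      rw [show ((1 : ArithmeticFunction ℂ) : ℕ → ℂ) = LSeries.delta from
        ArithmeticFunction.one_eq_delta]
      have h2 : LSeriesSummable LSeries.delta s := by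
        refine summable_of_hasFiniteSupport ((Set.finite_singleton 1).subset fun n hn => ?_)
        by_contra h
        exact hn (by simp [LSeries.term_delta, show n ≠ 1 from h])
      have h3 := h2.LSeriesHasSum
      rwa [LSeries_delta] at h3
    have h4 := h1.smul c
    simp only [MvPolynomial.algHom_C, Algebra.algebraMap_eq_smul_one]
    exact h4
  | add p q hp hq => rw [map_add, map_add, hadd]; exact hp.add hq
  | mul_X p i hp =>
    rw [map_mul, map_mul, MvPolynomial.aeval_X, MvPolynomial.aeval_X]
    exact ArithmeticFunction.LSeriesHasSum_mul hp (LSeries_logPowZeta i hs)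

/-- The Riemann zeta function satisfies no nontrivial autonomous algebraic differential equation
on the half plane of absolute convergence. -/
theorem riemannZeta_no_autonomous_ade {N : ℕ} (Q : MvPolynomial (Fin N) ℂ)
    (h : ∀ s : ℂ, 1 < s.re →
      MvPolynomial.aeval (fun j : Fin N => iteratedDeriv (j : ℕ) riemannZeta s) Q = 0) : Q = 0 := by
  have hsum : ∀ s : ℂ, 1 < s.re →
      LSeriesHasSum (MvPolynomial.aeval (fun j : Fin N => logPowZeta j) Q) s 0 := fun s hs =>
    h s hs ▸ LSeries_aeval_logPowZeta Q hs
  refine (algebraicIndependent_iff.mp (algebraicIndependent_logPowZeta N)) Q ?_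
  have habs : LSeries.abscissaOfAbsConv
      (MvPolynomial.aeval (fun j : Fin N => logPowZeta j) Q) < ⊤ :=
    lt_of_le_of_lt (LSeriesSummable.abscissaOfAbsConv_le (s := 2)
      (hsum 2 (by norm_num)).LSeriesSummable) (by simp)
  have hzero : LSeries.abscissaOfAbsConv (0 : ℕ → ℂ) < ⊤ :=
    lt_of_le_of_lt (LSeriesSummable.abscissaOfAbsConv_le (s := 2)
      (LSeriesSummable_zero (s := 2))) (by simp)
  ext n
  by_cases hn : n = 0
  · simp [hn]
  -- Uniqueness of Dirichlet expansions, from the values at large real t.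
  refine (LSeries.eq_of_LSeries_eventually_eq (g := 0) habs hzero ?_ hn)
  filter_upwards [eventually_gt_atTop (1 : ℝ)] with t ht
  rw [(hsum t (by rwa [Complex.ofReal_re])).LSeries_eq, LSeries_zero]
  rfl

/-! ### Derivations, algebraic elements and transcendence degree. -/

/-- Derivatives of algebraic elements are algebraic. -/
theorem IsAlgebraic.derivation {k A : Type*} [CommRing k] [CommRing A] [IsDomain A] [CharZero A]
    [Algebra k A] (D : Derivation k A A) (S : Subalgebra k A)
    (hS : ∀ a ∈ S, IsAlgebraic S (D a)) {x : A} (hx : IsAlgebraic S x) : IsAlgebraic S (D x) := by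
  classical
  have : CharZero S := ⟨fun m n h => by exact_mod_cast congrArg (algebraMap S A) h⟩
  have hex : ∃ n, ∃ p : Polynomial S, p ≠ 0 ∧ Polynomial.aeval x p = 0 ∧ p.natDegree = n := by
    obtain ⟨p, hp, hpx⟩ := hx
    exact ⟨_, p, hp, hpx, rfl⟩
  obtain ⟨p, hp, hpx, hdeg⟩ := Nat.find_spec hex
  have hmin : ∀ q : Polynomial S, q ≠ 0 → q.natDegree < p.natDegree →
      Polynomial.aeval x q ≠ 0 := fun q hq hlt h =>
    Nat.find_min hex (hdeg ▸ hlt) ⟨q, hq, h, rfl⟩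
  have hpos : p.natDegree ≠ 0 := by
    intro h0
    rw [Polynomial.eq_C_of_natDegree_eq_zero h0, Polynomial.aeval_C] at hpx
    have h1 : p.coeff 0 = 0 :=
      (map_eq_zero_iff _ (FaithfulSMul.algebraMap_injective S A)).mp hpx
    exact hp (by rw [Polynomial.eq_C_of_natDegree_eq_zero h0, h1, map_zero])
  have hd0 : Polynomial.derivative p ≠ 0 := by
    intro h
    exact hpos (Polynomial.derivative_eq_zero.mp h)
  have hd : Polynomial.aeval x (Polynomial.derivative p) ≠ 0 :=
    hmin _ hd0 (Polynomial.natDegree_derivative_lt hpos)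
  -- Here b is the value at x of q with `D` applied to its coefficients. For q = p, of minimal
  -- degree, p'(x) ≠ 0, and D(p(x)) = 0 exhibits p'(x) · D x as algebraic.
  have hchain : ∀ q : Polynomial S, ∃ b, IsAlgebraic S b ∧
      D (Polynomial.aeval x q) = b + Polynomial.aeval x (Polynomial.derivative q) * D x := by
    intro q
    induction q using Polynomial.induction_on' with
    | add p q hp hq =>
      obtain ⟨b, hb, h⟩ := hp
      obtain ⟨c, hc, h'⟩ := hq
      refine ⟨b + c, hb.add hc, ?_⟩
      simp only [map_add, h, h']
      ring
    | monomial n a =>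
      refine ⟨x ^ n * D a, (hx.pow n).mul (hS a a.2), ?_⟩
      simp only [Polynomial.aeval_monomial, Polynomial.derivative_monomial, Derivation.leibniz,
        Derivation.leibniz_pow, smul_eq_mul, nsmul_eq_mul, map_mul, map_natCast]
      change (a : A) * _ + x ^ n * D a = _ + (a : A) * _ * _ * _
      ring
  obtain ⟨b, hb, h⟩ := hchain p
  rw [hpx, map_zero] at h
  refine IsAlgebraic.of_mul (mem_nonZeroDivisors_of_ne_zero hd) ?_ ?_
  · rw [← Subalgebra.mem_algebraicClosure]
    exact Algebra.adjoin_le (S := Subalgebra.algebraicClosure S A) 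
      (Set.singleton_subset_iff.mpr hx)
      (Polynomial.aeval_mem_adjoin_singleton S x)
  · rw [show Polynomial.aeval x (Polynomial.derivative p) * D x = -b by linear_combination -h]
    exact hb.neg

/-- An element which is algebraic over a finitely generated subalgebra closed under derivation (up to
algebraic elements) satisfies an algebraic differential equation with constant coefficients. -/
theorem not_algebraicIndependent_iterate_derivation {k A : Type} [Field k] [CommRing A] [IsDomain A]
    [CharZero A] [Algebra k A] (D : Derivation k A A) {m : ℕ} (g : Fin m → A)
    (hg : ∀ i, IsAlgebraic (Algebra.adjoin k (Set.range g)) (D (g i))) {x : A}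
    (hx : IsAlgebraic (Algebra.adjoin k (Set.range g)) x) :
    ¬ AlgebraicIndependent k (fun j : Fin (m + 1) => D^[j] x) := by
  intro hind
  set S := Algebra.adjoin k (Set.range g) with hSdef
  have hS : ∀ a ∈ S, IsAlgebraic S (D a) := by
    intro a ha
    induction ha using Algebra.adjoin_induction with
    | mem a ha => obtain ⟨i, rfl⟩ := ha; exact hg i
    | algebraMap r => rw [Derivation.map_algebraMap]; exact isAlgebraic_zero
    | add a b _ _ ha hb => rw [map_add]; exact ha.add hb
    | mul a b ha' hb' ha hb =>
      rw [Derivation.leibniz, smul_eq_mul, smul_eq_mul]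
      exact ((isAlgebraic_algebraMap (⟨a, ha'⟩ : S)).mul hb).add
        ((isAlgebraic_algebraMap (⟨b, hb'⟩ : S)).mul ha)
  have hiter : ∀ j, IsAlgebraic S (D^[j] x) := by
    intro j
    induction j with
    | zero => exact hx
    | succ j ih => rw [Function.iterate_succ_apply']; exact ih.derivation D S hS
  -- All iterates lie in `B`, which has the transcendence degree of `S` over k, at most m; so m + 1
  -- of them cannot be independent.
  let B := Subalgebra.algebraicClosure S A
  let y : Fin (m + 1) → B := fun j => ⟨D^[j] x, hiter j⟩
  have hy : AlgebraicIndependent k y :=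
    AlgebraicIndependent.of_comp (B.val.restrictScalars k) hind
  have h1 := hy.lift_cardinalMk_le_trdeg
  have : FaithfulSMul S B := (faithfulSMul_iff_algebraMap_injective S B).mpr fun a b hab =>
    Subtype.ext (congrArg (fun c : B => (c : A)) hab)
  have h2 : Algebra.trdeg k S + Algebra.trdeg S B = Algebra.trdeg k B := trdeg_add_eq k S
  have h3 : Algebra.trdeg k S ≤ m := by
    let f : MvPolynomial (Fin m) k →ₐ[k] S :=
      MvPolynomial.aeval fun i => ⟨g i, Algebra.subset_adjoin ⟨i, rfl⟩⟩
    have hf : Function.Surjective f := by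
      rintro ⟨a, ha⟩
      rw [hSdef, Algebra.adjoin_range_eq_range_aeval] at ha
      obtain ⟨q, rfl⟩ := ha
      refine ⟨q, Subtype.ext ?_⟩
      have := MvPolynomial.comp_aeval_apply (fun i => (⟨g i, Algebra.subset_adjoin ⟨i, rfl⟩⟩ : S))
        S.val q
      exact this
    simpa [MvPolynomial.trdeg_of_isDomain] using trdeg_le_of_surjective f hf
  rw [trdeg_eq_zero (R := S), add_zero] at h2
  rw [← h2] at h1
  have h4 := h1.trans (Cardinal.lift_le.mpr h3)
  simp at h4

theorem coe_polynomial_mem_of_X_mem {B : Subalgebra ℂ (PowerSeries ℂ)} (hB : PowerSeries.X ∈ B)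
    (p : Polynomial ℂ) : (p : PowerSeries ℂ) ∈ B := by
  induction p using Polynomial.induction_on' with
  | add p q hp hq => rw [Polynomial.coe_add]; exact add_mem hp hq
  | monomial n a =>
    rw [← Polynomial.C_mul_X_pow_eq_monomial, Polynomial.coe_mul, Polynomial.coe_pow,
      Polynomial.coe_X, Polynomial.coe_C]
    exact mul_mem (B.algebraMap_mem a) (pow_mem hB _)

/-- Descent of algebraicity from Laurent series to power series. -/
theorem isAlgebraic_powerSeries_of_laurentSeries (s : Set (PowerSeries ℂ)) (x : PowerSeries ℂ)
    (h : IsAlgebraic (Algebra.adjoin (Polynomial ℂ)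
      ((fun y : PowerSeries ℂ => (y : LaurentSeries ℂ)) '' s)) (x : LaurentSeries ℂ)) :
    IsAlgebraic (Algebra.adjoin ℂ (insert PowerSeries.X s)) x := by
  set S := Algebra.adjoin (Polynomial ℂ) ((fun y : PowerSeries ℂ => (y : LaurentSeries ℂ)) '' s)
  set B := Algebra.adjoin ℂ (insert PowerSeries.X s)
  let φ : B →+* LaurentSeries ℂ := (HahnSeries.ofPowerSeries ℤ ℂ).comp B.val.toRingHom
  have hφ : Function.Injective φ :=
    HahnSeries.ofPowerSeries_injective.comp Subtype.val_injective
  have hS : ∀ c ∈ S, c ∈ φ.range := by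
    intro c hc
    induction hc using Algebra.adjoin_induction with
    | mem a ha =>
      obtain ⟨b, hb, rfl⟩ := ha
      exact ⟨⟨b, Algebra.subset_adjoin (Set.mem_insert_of_mem _ hb)⟩, rfl⟩
    | algebraMap p =>
      exact ⟨⟨(p : PowerSeries ℂ), coe_polynomial_mem_of_X_mem
        (Algebra.subset_adjoin (Set.mem_insert _ _)) p⟩, rfl⟩
    | add a b _ _ ha hb => exact add_mem ha hb
    | mul a b _ _ ha hb => exact mul_mem ha hb
  obtain ⟨p, hp, hpx⟩ := h
  have hlift : p.map (algebraMap S (LaurentSeries ℂ)) ∈ Polynomial.lifts φ := by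
    rw [Polynomial.lifts_iff_coeff_lifts]
    intro n
    rw [Polynomial.coeff_map]
    exact hS _ (p.coeff n).2
  obtain ⟨q, hq⟩ := (Polynomial.mem_lifts _).mp hlift
  refine ⟨q, ?_, ?_⟩
  · rintro rfl
    rw [Polynomial.map_zero] at hq
    exact hp ((Polynomial.map_eq_zero_iff (FaithfulSMul.algebraMap_injective S _)).mp hq.symm)
  · apply HahnSeries.ofPowerSeries_injective (Γ := ℤ)
    rw [map_zero, Polynomial.aeval_def, Polynomial.hom_eval₂]
    have h1 : Polynomial.eval₂ φ (x : LaurentSeries ℂ) q = 0 := by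
      rw [← Polynomial.eval_map, hq, Polynomial.eval_map]
      exact hpx
    exact h1

/-! ### Dictionary between analytic germs and Taylor series. -/

/-- `f` is analytic at `z₀`, with Taylor series `φ`. -/
def HasTaylor (f : ℂ → ℂ) (z₀ : ℂ) (φ : PowerSeries ℂ) : Prop :=
  AnalyticAt ℂ f z₀ ∧ taylorSeriesAt f z₀ = φ

namespace HasTaylor

variable {f g : ℂ → ℂ} {z₀ : ℂ} {φ ψ : PowerSeries ℂ}

theorem coeff (hf : HasTaylor f z₀ φ) (n : ℕ) :
    PowerSeries.coeff n φ = iteratedDeriv n f z₀ / (n.factorial : ℂ) := by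
  rw [← hf.2, taylorSeriesAt, PowerSeries.coeff_mk]

theorem congr (hf : HasTaylor f z₀ φ) (h : f =ᶠ[𝓝 z₀] g) : HasTaylor g z₀ φ := by
  refine ⟨hf.1.congr h, ?_⟩
  ext n
  rw [hf.coeff, taylorSeriesAt, PowerSeries.coeff_mk, h.iteratedDeriv_eq]

theorem add (hf : HasTaylor f z₀ φ) (hg : HasTaylor g z₀ ψ) :
    HasTaylor (fun z => f z + g z) z₀ (φ + ψ) := by
  refine ⟨hf.1.add hg.1, ?_⟩
  ext n
  rw [map_add, hf.coeff, hg.coeff, taylorSeriesAt, PowerSeries.coeff_mk, ← add_div]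
  congr 1
  exact iteratedDeriv_fun_add hf.1.contDiffAt hg.1.contDiffAt

theorem mul (hf : HasTaylor f z₀ φ) (hg : HasTaylor g z₀ ψ) :
    HasTaylor (fun z => f z * g z) z₀ (φ * ψ) := by
  refine ⟨hf.1.mul hg.1, ?_⟩
  ext n
  rw [PowerSeries.coeff_mul, taylorSeriesAt, PowerSeries.coeff_mk,
    Finset.Nat.sum_antidiagonal_eq_sum_range_succ_mk]
  rw [iteratedDeriv_fun_mul hf.1.contDiffAt hg.1.contDiffAt, Finset.sum_div]
  refine Finset.sum_congr rfl fun i hi => ?_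
  have hi : i ≤ n := by simpa [Nat.lt_succ_iff] using hi
  rw [hf.coeff, hg.coeff, Nat.cast_choose ℂ hi]
  have h1 : (n.factorial : ℂ) ≠ 0 := by exact_mod_cast n.factorial_ne_zero
  have h2 : (i.factorial : ℂ) ≠ 0 := by exact_mod_cast i.factorial_ne_zero
  have h3 : ((n - i).factorial : ℂ) ≠ 0 := by exact_mod_cast (n - i).factorial_ne_zero
  field_simp

theorem const (c : ℂ) : HasTaylor (fun _ => c) z₀ (PowerSeries.C c) := by
  refine ⟨analyticAt_const, ?_⟩
  ext n
  rw [taylorSeriesAt, PowerSeries.coeff_mk, PowerSeries.coeff_C, iteratedDeriv_const]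
  split_ifs with h <;> simp [h]

theorem sub_center : HasTaylor (fun z => z - z₀) z₀ PowerSeries.X := by
  refine ⟨analyticAt_id.sub analyticAt_const, ?_⟩
  ext n
  rw [taylorSeriesAt, PowerSeries.coeff_mk, PowerSeries.coeff_X]
  rcases n with _ | _ | n
  · simp
  · simp
  · rw [iteratedDeriv_succ', show deriv (fun z => z - z₀) = fun _ => (1 : ℂ) by
      funext z; simp, iteratedDeriv_const]
    simp

theorem pow (hf : HasTaylor f z₀ φ) (n : ℕ) : HasTaylor (fun z => f z ^ n) z₀ (φ ^ n) := by
  induction n with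
  | zero => simpa using const (z₀ := z₀) 1
  | succ n ih => simpa [pow_succ] using ih.mul hf

theorem sum {ι : Type*} (s : Finset ι) {f : ι → ℂ → ℂ} {φ : ι → PowerSeries ℂ}
    (h : ∀ i ∈ s, HasTaylor (f i) z₀ (φ i)) :
    HasTaylor (fun z => ∑ i ∈ s, f i z) z₀ (∑ i ∈ s, φ i) := by
  classical
  induction s using Finset.induction_on with
  | empty => simpa using const (z₀ := z₀) 0
  | insert a s ha ih =>
    simp only [Finset.sum_insert ha]
    exact (h a (by simp)).add (ih fun i hi => h i (by simp [hi]))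

theorem aeval {ι : Type*} {f : ι → ℂ → ℂ} {φ : ι → PowerSeries ℂ}
    (h : ∀ i, HasTaylor (f i) z₀ (φ i)) (Q : MvPolynomial ι ℂ) :
    HasTaylor (fun z => MvPolynomial.aeval (fun i => f i z) Q) z₀ (MvPolynomial.aeval φ Q) := by
  induction Q using MvPolynomial.induction_on with
  | C c => simpa using const (z₀ := z₀) c
  | add p q hp hq => simpa using hp.add hq
  | mul_X p i hp => simpa using hp.mul (h i)

theorem polynomial (p : Polynomial ℂ) :
    HasTaylor (fun z => p.eval z) z₀ (p.comp (Polynomial.X + Polynomial.C z₀) : Polynomial ℂ) := by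
  induction p using Polynomial.induction_on' with
  | add p q hp hq => simpa using hp.add hq
  | monomial n a =>
    have := (const (z₀ := z₀) a).mul (((sub_center (z₀ := z₀)).add (const z₀)).pow n)
    simpa [← Polynomial.C_mul_X_pow_eq_monomial] using this

theorem deriv (hf : HasTaylor f z₀ φ) :
    HasTaylor (deriv f) z₀ (PowerSeries.derivative ℂ φ) := by
  refine ⟨hf.1.deriv, ?_⟩
  ext n
  rw [PowerSeries.coeff_derivative, hf.coeff, taylorSeriesAt, PowerSeries.coeff_mk,
    iteratedDeriv_succ', Nat.factorial_succ]
  have h1 : (n.factorial : ℂ) ≠ 0 := by exact_mod_cast n.factorial_ne_zero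
  have h2 : (n : ℂ) + 1 ≠ 0 := by exact_mod_cast n.succ_ne_zero
  push_cast
  field_simp

theorem iteratedDeriv (hf : HasTaylor f z₀ φ) (j : ℕ) :
    HasTaylor (iteratedDeriv j f) z₀ ((PowerSeries.derivative ℂ)^[j] φ) := by
  induction j with
  | zero => simpa using hf
  | succ j ih => rw [Function.iterate_succ_apply', iteratedDeriv_succ]; exact ih.deriv

theorem eventually_eq_zero (hf : HasTaylor f z₀ 0) : ∀ᶠ z in 𝓝 z₀, f z = 0 := by
  have h := hf.1.hasFPowerSeriesAt
  have h0 : (fun n => _root_.iteratedDeriv n f z₀ / (n.factorial : ℂ)) = 0 := by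
    funext n
    rw [← hf.coeff, map_zero]
    rfl
  rw [h0, (FormalMultilinearSeries.ofScalars_series_eq_zero_of_scalar_zero ℂ)] at h
  exact h.eventually_eq_zero

theorem eq_zero_iff (hf : HasTaylor f z₀ φ) : φ = 0 ↔ ∀ᶠ z in 𝓝 z₀, f z = 0 := by
  constructor
  · rintro rfl; exact hf.eventually_eq_zero
  · intro h
    have h1 := hf.congr (g := fun _ => 0) h
    rw [← h1.2, (const (z₀ := z₀) 0).2, map_zero]

end HasTaylor

theorem AnalyticAt.hasTaylor {f : ℂ → ℂ} {z₀ : ℂ} (hf : AnalyticAt ℂ f z₀) :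
    HasTaylor f z₀ (taylorSeriesAt f z₀) := ⟨hf, rfl⟩

theorem Polynomial.eventually_eval_ne_zero {p : Polynomial ℂ} (hp : p ≠ 0) (z₀ : ℂ) :
    ∀ᶠ z in 𝓝[≠] z₀, p.eval z ≠ 0 := by
  have hfin : (p.rootSet ℂ).Finite := p.rootSet_finite ℂ
  have : ((p.rootSet ℂ) \ {z₀})ᶜ ∈ 𝓝 z₀ :=
    (hfin.subset Set.sdiff_subset).isClosed.isOpen_compl.mem_nhds (by simp)
  filter_upwards [mem_nhdsWithin_of_mem_nhds this, self_mem_nhdsWithin] with z hz hz0 h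
  exact hz ⟨by rw [Polynomial.mem_rootSet]; exact ⟨hp, by simpa using h⟩, hz0⟩

theorem Polynomial.not_eventually_eval_eq_zero {p : Polynomial ℂ} (hp : p ≠ 0) (z₀ : ℂ) :
    ¬ ∀ᶠ z in 𝓝 z₀, p.eval z = 0 := fun h =>
  ((Polynomial.eventually_eval_ne_zero hp z₀).and (h.filter_mono nhdsWithin_le_nhds)).exists.elim
    fun _ h => h.1 h.2

/-! ### Transcendence of ζ over a D-finite function. -/

/-- The order of the differential equation of a `D`-finite function may be taken positive. -/
theorem IsDFiniteAt.exists_pos_order {G : ℂ → ℂ} {z₀ : ℂ} (hG : IsDFiniteAt G z₀) :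
    ∃ (r : ℕ) (p : ℕ → Polynomial ℂ), 0 < r ∧ p r ≠ 0 ∧
      ∀ᶠ z in 𝓝 z₀, ∑ i ∈ Finset.range (r + 1), (p i).eval z * iteratedDeriv i G z = 0 := by
  obtain ⟨hGa, r, p, hp, h⟩ := hG
  rcases Nat.eq_zero_or_pos r with rfl | hr
  -- An equation of order 0 forces G = 0 near z₀, so that G' = 0 will do.
  · refine ⟨1, fun i => if i = 1 then 1 else 0, one_pos, by simp, ?_⟩
    have hG0 : ∀ᶠ z in 𝓝 z₀, G z = 0 := by
      rcases hGa.eventually_eq_zero_or_eventually_ne_zero with h0 | h0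
      · exact h0
      · exfalso
        obtain ⟨z, h1, h2, h3⟩ := ((Polynomial.eventually_eval_ne_zero hp z₀).and
          (h0.and (h.filter_mono nhdsWithin_le_nhds))).exists
        simp at h3
        tauto
    filter_upwards [hG0.eventually_nhds] with z hz
    have : deriv G z = 0 := by
      rw [Filter.EventuallyEq.deriv_eq (f := fun _ => 0) hz]; simp
    simp [Finset.sum_range_succ, this]
  · exact ⟨r, p, hr, hp, h⟩

theorem analyticOnNhd_riemannZeta : AnalyticOnNhd ℂ riemannZeta {1}ᶜ :=
  DifferentiableOn.analyticOnNhd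
    (fun _ hz => (differentiableAt_riemannZeta hz).differentiableWithinAt) isOpen_compl_singleton

/-- The Taylor series of the derivatives of the zeta function are algebraically independent. -/
theorem algebraicIndependent_derivative_zeta {z₀ : ℂ} (hz₀ : z₀ ≠ 1) (N : ℕ) :
    AlgebraicIndependent ℂ (fun j : Fin N =>
      (PowerSeries.derivative ℂ)^[j] (taylorSeriesAt riemannZeta z₀)) := by
  rw [algebraicIndependent_iff]
  intro Q hQ
  refine riemannZeta_no_autonomous_ade Q fun s hs => ?_
  have hz : HasTaylor riemannZeta z₀ _ := (analyticOnNhd_riemannZeta z₀ hz₀).hasTaylor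
  have h := HasTaylor.aeval (fun j : Fin N => hz.iteratedDeriv (j : ℕ)) Q
  rw [hQ] at h
  have han : ∀ j, AnalyticOnNhd ℂ (iteratedDeriv j riemannZeta) {1}ᶜ := fun j => by
    induction j with
    | zero => simpa using analyticOnNhd_riemannZeta
    | succ j ih => rw [iteratedDeriv_succ]; exact ih.deriv
  have han' : AnalyticOnNhd ℂ (fun z => MvPolynomial.aeval
      (fun j : Fin N => iteratedDeriv (j : ℕ) riemannZeta z) Q) {1}ᶜ := fun w hw =>
    (HasTaylor.aeval (fun j : Fin N => (han j w hw).hasTaylor) Q).1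
  -- The plane without 1 is connected, so a relation near z₀ spreads to the half plane of absolute
  -- convergence.
  have hconn : IsPreconnected ({1}ᶜ : Set ℂ) :=
    (isConnected_compl_singleton_of_one_lt_rank (by simp) 1).isPreconnected
  have := han'.eqOn_zero_of_preconnected_of_eventuallyEq_zero hconn hz₀ h.eventually_eq_zero
  exact this (show s ≠ 1 by rintro rfl; simp at hs)

/-- The zeta function is transcendental over `ℂ(z, G)`, for `D`-finite `G`. -/
theorem IsDFiniteAt.transcendental_zeta {G : ℂ → ℂ} {z₀ : ℂ} (hG : IsDFiniteAt G z₀)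
    (hz₀ : z₀ ≠ 1) :
    Transcendental (Algebra.adjoin ℂ {PowerSeries.X, taylorSeriesAt G z₀})
      (taylorSeriesAt riemannZeta z₀) := by
  intro halg
  obtain ⟨r, p, hr, hp, h⟩ := hG.exists_pos_order
  set D := PowerSeries.derivative ℂ
  have hGt := hG.1.hasTaylor
  set φ := taylorSeriesAt G z₀
  -- The generators are X, G, …, G^(r-1); G is among them because r > 0. Only the derivative of the
  -- last one leaves the list, and the equation puts p_r G^(r) back into `S`. With r + 1 generators,
  -- r + 2 derivatives of ζ are needed for a contradiction.
  let g : Fin (r + 1) → PowerSeries ℂ := Fin.cons PowerSeries.X (fun i : Fin r => D^[i] φ)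
  set S := Algebra.adjoin ℂ (Set.range g)
  have hX : PowerSeries.X ∈ S := Algebra.subset_adjoin ⟨0, rfl⟩
  have hD : ∀ i < r, D^[i] φ ∈ S := fun i hi =>
    Algebra.subset_adjoin ⟨Fin.succ ⟨i, hi⟩, by simp only [g, Fin.cons_succ]⟩
  have halg' : ∀ a ∈ S, IsAlgebraic S a := fun a ha => isAlgebraic_algebraMap (⟨a, ha⟩ : S)
  have hle : Algebra.adjoin ℂ {PowerSeries.X, φ} ≤ S := by
    refine Algebra.adjoin_le ?_
    rintro _ (rfl | rfl)
    · exact hX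
    · exact hD 0 hr
  have : CharZero (PowerSeries ℂ) :=
    charZero_of_injective_algebraMap (algebraMap ℂ (PowerSeries ℂ)).injective
  refine not_algebraicIndependent_iterate_derivation D g ?_ ?_
    (algebraicIndependent_derivative_zeta hz₀ (r + 2))
  · intro i
    refine Fin.cases ?_ (fun i => ?_) i
    · have : D (g 0) = 1 := by simp [g, D]
      rw [this]
      exact isAlgebraic_one
    · have : D (g i.succ) = D^[i + 1] φ := by
        rw [Function.iterate_succ_apply']; simp [g]
      rw [this]
      rcases Nat.lt_or_ge (i + 1) r with hlt | hge
      · exact halg' _ (hD _ hlt)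
      · have hi : (i : ℕ) + 1 = r := by omega
        rw [hi]
        have hsum := HasTaylor.sum (Finset.range (r + 1)) fun i _ =>
          (HasTaylor.polynomial (z₀ := z₀) (p i)).mul (hGt.iteratedDeriv i)
        rw [← hsum.eq_zero_iff, Finset.sum_range_succ] at h
        refine IsAlgebraic.of_mul (R := S) (y := (((p r).comp (Polynomial.X + Polynomial.C z₀) :
          Polynomial ℂ) : PowerSeries ℂ)) (mem_nonZeroDivisors_of_ne_zero ?_)
          (halg' _ (coe_polynomial_mem_of_X_mem hX _)) ?_
        · intro h0
          exact Polynomial.not_eventually_eval_eq_zero hp z₀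
            ((HasTaylor.polynomial (p r)).eq_zero_iff.mp h0)
        · rw [eq_neg_of_add_eq_zero_right h]
          refine (halg' _ (sum_mem fun j hj => mul_mem (coe_polynomial_mem_of_X_mem hX _) ?_)).neg
          exact hD _ (Finset.mem_range.mp hj)
  · let _ : Algebra (Algebra.adjoin ℂ {PowerSeries.X, φ}) S := (Subalgebra.inclusion hle).toAlgebra
    have : IsScalarTower (Algebra.adjoin ℂ {PowerSeries.X, φ}) S (PowerSeries ℂ) :=
      .of_algebraMap_eq fun _ => rfl
    exact halg.extendScalars (Subalgebra.inclusion_injective hle)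

/-! ### Analytic continuation of solutions of linear differential equations. -/

/-- From one term of T n · s^n to the next the factor is at most s(a + b/(n+1)), with limit sa < 1,
so the sequence is eventually non-increasing. -/
theorem exists_bound_mul_pow_of_recurrence {T : ℕ → ℝ} (hT : ∀ n, 0 ≤ T n) {a b s : ℝ}
    (h : ∀ n, T (n + 1) ≤ T n * (a + b / (n + 1))) (hs : 0 ≤ s) (hsa : s * a < 1) :
    ∃ C, ∀ n, T n * s ^ n ≤ C := by
  have hlim : Tendsto (fun n : ℕ => s * (a + b / ((n : ℝ) + 1))) atTop (𝓝 (s * a)) := by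
    have : Tendsto (fun n : ℕ => b / ((n : ℝ) + 1)) atTop (𝓝 0) :=
      tendsto_const_nhds.div_atTop (tendsto_atTop_add_const_right _ _ tendsto_natCast_atTop_atTop)
    simpa using (this.const_add a).const_mul s
  obtain ⟨N, hN⟩ := eventually_atTop.mp (hlim.eventually_lt_const hsa)
  have hmono : ∀ n ≥ N, T n * s ^ n ≤ T N * s ^ N := by
    intro n hn
    induction n, hn using Nat.le_induction with
    | base => exact le_rfl
    | succ n hn ih =>
      refine le_trans ?_ ih
      calc T (n + 1) * s ^ (n + 1) ≤ T n * (a + b / (n + 1)) * s ^ (n + 1) :=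
            mul_le_mul_of_nonneg_right (h n) (pow_nonneg hs _)
        _ = T n * s ^ n * (s * (a + b / (n + 1))) := by ring
        _ ≤ T n * s ^ n * 1 := mul_le_mul_of_nonneg_left (hN n hn).le
            (mul_nonneg (hT n) (pow_nonneg hs _))
        _ = T n * s ^ n := mul_one _
  refine ⟨∑ i ∈ Finset.range (N + 1), T i * s ^ i, fun n => ?_⟩
  have hnn : ∀ i, 0 ≤ T i * s ^ i := fun i => mul_nonneg (hT i) (pow_nonneg hs _)
  rcases le_total n N with hle | hle
  · exact Finset.single_le_sum (f := fun i => T i * s ^ i) (fun i _ => hnn i)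
      (Finset.mem_range.mpr (by omega))
  · exact (hmono n hle).trans (Finset.single_le_sum (f := fun i => T i * s ^ i)
      (fun i _ => hnn i) (Finset.mem_range.mpr (by omega)))

theorem iteratedDeriv_iteratedDeriv' (n i : ℕ) (f : ℂ → ℂ) :
    iteratedDeriv n (iteratedDeriv i f) = iteratedDeriv (n + i) f := by
  rw [iteratedDeriv_eq_iterate, iteratedDeriv_eq_iterate, iteratedDeriv_eq_iterate,
    Function.iterate_add_apply]

/-- Growth of the Taylor coefficients of a solution of a linear differential equation with
analytic coefficients. -/
theorem exists_bound_iteratedDeriv_of_linearODE {r : ℕ} (hr : 0 < r) {b : ℕ → ℂ → ℂ} {w : ℂ}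
    {R s : ℝ} (hs : 0 ≤ s) (hsR : s < R)
    (hb : ∀ i, DiffContOnCl ℂ (b i) (Metric.ball w R)) {G : ℂ → ℂ} (hG : AnalyticAt ℂ G w)
    (h : iteratedDeriv r G =ᶠ[𝓝 w] fun z => ∑ i ∈ Finset.range r, b i z * iteratedDeriv i G z) :
    ∃ C, ∀ n, ‖iteratedDeriv n G w / (n.factorial : ℂ)‖ * s ^ n ≤ C := by
  have hR : 0 < R := hs.trans_lt hsR
  obtain ⟨M, hM0, hM⟩ : ∃ M, 0 ≤ M ∧ ∀ i < r, ∀ z ∈ Metric.sphere w R, ‖b i z‖ ≤ M := by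
    have hcont : ∀ i, ContinuousOn (b i) (Metric.sphere w R) := fun i =>
      (hb i).continuousOn.mono (by rw [closure_ball w hR.ne']; exact Metric.sphere_subset_closedBall)
    choose B hB using fun i => (isCompact_sphere w R).exists_bound_of_continuousOn (hcont i)
    refine ⟨∑ i ∈ Finset.range r, |B i|, Finset.sum_nonneg fun i _ => abs_nonneg _,
      fun i hi z hz => ((hB i z hz).trans (le_abs_self _)).trans ?_⟩
    exact Finset.single_le_sum (f := fun i => |B i|) (fun i _ => abs_nonneg _)
      (Finset.mem_range.mpr hi)
  have hbd : ∀ i < r, ∀ k, ‖iteratedDeriv k (b i) w‖ ≤ k.factorial * M / R ^ k := fun i hi k =>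
    Complex.norm_iteratedDeriv_le_of_forall_mem_sphere_norm_le k hR (hb i) (hM i hi)
  set d : ℕ → ℝ := fun n => ‖iteratedDeriv n G w‖ with hd
  have hd0 : ∀ n, 0 ≤ d n := fun n => norm_nonneg _
  -- `e m` is a window of r derivatives starting at order m, and `T` is its convolution with the
  -- weights R^(-k) of Cauchy's estimates. By Leibniz's rule, M · n! · `T n` bounds the n-th
  -- derivative of the right-hand side of the equation.
  set e : ℕ → ℝ := fun m => (∑ i ∈ Finset.range r, d (m + i)) / m.factorial with he
  have he0 : ∀ n, 0 ≤ e n := fun n =>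
    div_nonneg (Finset.sum_nonneg fun i _ => hd0 _) (Nat.cast_nonneg _)
  set T : ℕ → ℝ := fun n => ∑ k ∈ Finset.range (n + 1), e (n - k) / R ^ k with hT
  have hT0 : ∀ n, 0 ≤ T n := fun n =>
    Finset.sum_nonneg fun k _ => div_nonneg (he0 _) (pow_nonneg hR.le _)
  have heT : ∀ n, e n ≤ T n := fun n => by
    have := Finset.single_le_sum (f := fun k => e (n - k) / R ^ k) (s := Finset.range (n + 1))
      (fun k _ => div_nonneg (he0 _) (pow_nonneg hR.le _)) (Finset.mem_range.mpr n.succ_pos)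
    simpa using this
  have hba : ∀ i, AnalyticAt ℂ (b i) w := fun i =>
    (hb i).differentiableOn.analyticAt (Metric.ball_mem_nhds w hR)
  have hGi : ∀ i, AnalyticAt ℂ (iteratedDeriv i G) w := fun i => (hG.hasTaylor.iteratedDeriv i).1
  have hrec : ∀ n, d (n + r) / n.factorial ≤ M * T n := by
    intro n
    have h1 : iteratedDeriv (n + r) G w = ∑ i ∈ Finset.range r,
        ∑ k ∈ Finset.range (n + 1), (n.choose k : ℂ) * iteratedDeriv k (b i) w *
          iteratedDeriv (n - k + i) G w := by
      rw [← iteratedDeriv_iteratedDeriv', h.iteratedDeriv_eq, iteratedDeriv_fun_sum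
        (f := fun i z => b i z * iteratedDeriv i G z)
        (fun i _ => ((hba i).mul (hGi i)).contDiffAt)]
      refine Finset.sum_congr rfl fun i _ => ?_
      rw [iteratedDeriv_fun_mul (hba i).contDiffAt (hGi i).contDiffAt]
      simp only [iteratedDeriv_iteratedDeriv']
    have h2 : d (n + r) ≤ ∑ i ∈ Finset.range r, ∑ k ∈ Finset.range (n + 1),
        (n.factorial : ℝ) * M * (d (n - k + i) / (n - k).factorial / R ^ k) := by
      rw [hd]
      simp only
      rw [h1]
      refine (norm_sum_le _ _).trans (Finset.sum_le_sum fun i hi => (norm_sum_le _ _).trans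
        (Finset.sum_le_sum fun k hk => ?_))
      have hk : k ≤ n := by simpa [Nat.lt_succ_iff] using hk
      rw [norm_mul, norm_mul, Complex.norm_natCast, Nat.cast_choose ℝ hk]
      have hk1 : (k.factorial : ℝ) ≠ 0 := by exact_mod_cast k.factorial_ne_zero
      have hk2 : ((n - k).factorial : ℝ) ≠ 0 := by exact_mod_cast (n - k).factorial_ne_zero
      calc (n.factorial : ℝ) / (k.factorial * (n - k).factorial) * ‖iteratedDeriv k (b i) w‖ *
            ‖iteratedDeriv (n - k + i) G w‖
          ≤ (n.factorial : ℝ) / (k.factorial * (n - k).factorial) * (k.factorial * M / R ^ k) *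
            ‖iteratedDeriv (n - k + i) G w‖ := by
              gcongr
              exact hbd i (Finset.mem_range.mp hi) k
        _ = _ := by field_simp
    rw [Finset.sum_comm] at h2
    have hn : (0 : ℝ) < n.factorial := by exact_mod_cast n.factorial_pos
    rw [div_le_iff₀ hn]
    refine h2.trans (le_of_eq ?_)
    simp only [hT, he, ← Finset.mul_sum, ← Finset.sum_div]
    ring
  -- Splitting off k = 0 leaves `T n / R`. In `e (n + 1)` the window loses one derivative and gains
  -- `d (n + r)`, bounded by `hrec`, while the factorial yields 1/(n+1). The growth factor tends to
  -- 1/R.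
  have hstep : ∀ n, T (n + 1) ≤ T n * (1 / R + (1 + M) / (n + 1)) := by
    intro n
    have h1 : T (n + 1) = T n / R + e (n + 1) := by
      simp only [hT]
      rw [Finset.sum_range_succ' _ (n + 1), Finset.sum_div]
      congr 1
      · refine Finset.sum_congr rfl fun k _ => ?_
        rw [Nat.add_sub_add_right, pow_succ, ← div_div]
      · simp
    have h2 : e (n + 1) ≤ (e n + M * T n) / (n + 1) := by
      have hsum : ∑ i ∈ Finset.range r, d (n + 1 + i) ≤
          (∑ i ∈ Finset.range r, d (n + i)) + d (n + r) := by
        rw [← Finset.sum_range_succ (fun i => d (n + i)), Finset.sum_range_succ' _ r]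
        simp only [add_assoc, add_comm 1]
        exact le_add_of_nonneg_right (hd0 _)
      have hn : (0 : ℝ) < n.factorial := by exact_mod_cast n.factorial_pos
      have hn1 : (0 : ℝ) < (n : ℝ) + 1 := by positivity
      calc e (n + 1) = (∑ i ∈ Finset.range r, d (n + 1 + i)) / n.factorial / (n + 1) := by
            simp only [he]
            rw [Nat.factorial_succ, Nat.cast_mul, div_div, mul_comm]
            push_cast
            rfl
        _ ≤ ((∑ i ∈ Finset.range r, d (n + i)) + d (n + r)) / n.factorial / (n + 1) := by gcongr
        _ = (e n + d (n + r) / n.factorial) / (n + 1) := by rw [add_div]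
        _ ≤ (e n + M * T n) / (n + 1) := by gcongr; exact hrec n
    calc T (n + 1) ≤ T n / R + (T n + M * T n) / (n + 1) := by
          rw [h1]
          have : (0 : ℝ) < (n : ℝ) + 1 := by positivity
          gcongr
          exact h2.trans (by gcongr; exact heT n)
      _ = _ := by ring
  obtain ⟨C, hC⟩ := exists_bound_mul_pow_of_recurrence hT0 hstep hs
    (by rw [mul_one_div, div_lt_one hR]; exact hsR)
  refine ⟨C, fun n => le_trans (mul_le_mul_of_nonneg_right ?_ (pow_nonneg hs _)) (hC n)⟩
  refine le_trans ?_ (heT n)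
  rw [norm_div, Complex.norm_natCast]
  simp only [he]
  gcongr
  exact Finset.single_le_sum (f := fun i => d (n + i)) (fun i _ => hd0 _) (Finset.mem_range.mpr hr)

/-- A solution of a linear differential equation extends to any disc around its base point on which
the leading coefficient does not vanish. -/
theorem exists_analyticOnNhd_extension {r : ℕ} (hr : 0 < r) {p : ℕ → Polynomial ℂ} {w : ℂ}
    {δ : ℝ} (hδ : 0 < δ) (hp : ∀ z ∈ Metric.ball w δ, (p r).eval z ≠ 0) {G : ℂ → ℂ}
    (hG : AnalyticAt ℂ G w)
    (h : ∀ᶠ z in 𝓝 w, ∑ i ∈ Finset.range (r + 1), (p i).eval z * iteratedDeriv i G z = 0) :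
    ∃ g : ℂ → ℂ, AnalyticOnNhd ℂ g (Metric.ball w δ) ∧ g =ᶠ[𝓝 w] G := by
  set P := FormalMultilinearSeries.ofScalars ℂ
    (fun n => iteratedDeriv n G w / (n.factorial : ℂ)) with hP
  have hrad : ENNReal.ofReal δ ≤ P.radius := by
    refine ENNReal.le_of_forall_nnreal_lt fun s hs => ?_
    have hsδ : (s : ℝ) < δ := by
      rw [ENNReal.lt_ofReal_iff_toReal_lt (by simp)] at hs
      simpa using hs
    -- Cauchy's estimates need the coefficients on a closed disc, hence a radius strictly below δ.
    obtain ⟨R, hsR, hRδ⟩ := exists_between hsδ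
    have hR : 0 < R := s.2.trans_lt hsR
    have hsub : closure (Metric.ball w R) ⊆ Metric.ball w δ := by
      rw [closure_ball w hR.ne']
      exact Metric.closedBall_subset_ball hRδ
    obtain ⟨C, hC⟩ := exists_bound_iteratedDeriv_of_linearODE (b := fun i z =>
      -((p i).eval z) / (p r).eval z) hr s.2 hsR (fun i => by
        refine DifferentiableOn.diffContOnCl fun z hz => DifferentiableAt.differentiableWithinAt ?_
        exact ((p i).differentiable z).neg.div ((p r).differentiable z) (hp z (hsub hz))) hG (by
        filter_upwards [h, Metric.ball_mem_nhds w hδ] with z hz hzb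
        have hz0 := hp z hzb
        rw [Finset.sum_range_succ] at hz
        have h1 : ∀ i, -((p i).eval z) / (p r).eval z * iteratedDeriv i G z =
          -(((p i).eval z * iteratedDeriv i G z) / (p r).eval z) := fun i => by ring
        simp only [h1, Finset.sum_neg_distrib, ← Finset.sum_div]
        rw [eq_neg_of_add_eq_zero_left hz, neg_div, neg_neg]
        field_simp)
    refine P.le_radius_of_bound C fun n => ?_
    refine le_trans ?_ (hC n)
    refine mul_le_mul_of_nonneg_right ?_ (pow_nonneg s.2 _)
    rw [hP, FormalMultilinearSeries.ofScalars_norm]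
  have hpos : 0 < P.radius := lt_of_lt_of_le (by simpa using hδ) hrad
  have hball := (P.hasFPowerSeriesOnBall hpos).comp_sub w
  rw [zero_add] at hball
  refine ⟨fun z => P.sum (z - w), fun z hz => ?_, ?_⟩
  · refine hball.analyticAt_of_mem ?_
    refine Metric.eball_subset_eball hrad ?_
    rw [Metric.eball_ofReal]
    exact hz
  · have hsub := hball.hasFPowerSeriesAt.sub hG.hasFPowerSeriesAt
    rw [← hP, sub_self] at hsub
    filter_upwards [hsub.eventually_eq_zero] with z hz
    exact sub_eq_zero.mp hz

/-! ### Continuing an algebraic relation to the unit circle. -/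

theorem MeromorphicOn.eventually_eq_zero_of_isPreconnected {h : ℂ → ℂ} {U : Set ℂ}
    (hh : MeromorphicOn h U) (hU : IsPreconnected U) {x y : ℂ} (hx : x ∈ U) (hy : y ∈ U)
    (h0 : ∀ᶠ z in 𝓝[≠] x, h z = 0) : ∀ᶠ z in 𝓝[≠] y, h z = 0 := by
  rw [← meromorphicOrderAt_eq_top_iff] at h0 ⊢
  by_contra hne
  exact hh.meromorphicOrderAt_ne_top_of_isPreconnected hU hy hx hne h0

/-- `f` is, near the point `ξ` of the unit circle, algebraic over the germs of analytic functions
at `ξ`. -/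
def AlgebraicAtBoundary (f : ℂ → ℂ) (ξ : ℂ) : Prop :=
  ∃ (N : ℕ) (h : ℕ → ℂ → ℂ), (∀ j, AnalyticAt ℂ (h j) ξ) ∧
    (∃ j ≤ N, ¬ ∀ᶠ z in 𝓝 ξ, h j z = 0) ∧
    ∃ ε > 0, ∀ z ∈ Metric.ball ξ ε ∩ Metric.ball 0 1,
      ∀ᶠ w in 𝓝[≠] z, ∑ j ∈ Finset.range (N + 1), h j w * f w ^ j = 0

/-- The value at `z` of a polynomial in `z - z₀`, `g` and the zeta function. -/
noncomputable def zetaPolyEval (z₀ : ℂ) (Q : MvPolynomial (Fin 3) ℂ) (g : ℂ → ℂ) (z : ℂ) : ℂ :=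
  MvPolynomial.aeval (fun i => (![fun z => z - z₀, g, riemannZeta] : Fin 3 → ℂ → ℂ) i z) Q

theorem HasTaylor.zetaPolyEval {g : ℂ → ℂ} {z₀ : ℂ} {φ : PowerSeries ℂ} (hg : HasTaylor g z₀ φ)
    (hz₀ : z₀ ≠ 1) (Q : MvPolynomial (Fin 3) ℂ) :
    HasTaylor (zetaPolyEval z₀ Q g) z₀
      (MvPolynomial.aeval ![PowerSeries.X, φ, taylorSeriesAt riemannZeta z₀] Q) := by
  refine HasTaylor.aeval (fun i => ?_) Q
  fin_cases i
  · exact HasTaylor.sub_center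
  · exact hg
  · exact (analyticOnNhd_riemannZeta z₀ hz₀).hasTaylor

theorem AnalyticAt.zetaPolyEval {g : ℂ → ℂ} {z : ℂ} (hg : AnalyticAt ℂ g z)
    (hz : z ≠ 1) (z₀ : ℂ) (Q : MvPolynomial (Fin 3) ℂ) :
    AnalyticAt ℂ (zetaPolyEval z₀ Q g) z := by
  refine (HasTaylor.aeval (z₀ := z) (φ := fun i => taylorSeriesAt
    ((![fun z => z - z₀, g, riemannZeta] : Fin 3 → ℂ → ℂ) i) z) (fun i => ?_) Q).1
  refine AnalyticAt.hasTaylor ?_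
  fin_cases i
  · exact analyticAt_id.sub analyticAt_const
  · exact hg
  · exact analyticOnNhd_riemannZeta z hz

theorem zetaPolyEval_congr {g g' : ℂ → ℂ} {z z₀ : ℂ} (h : g z = g' z)
    (Q : MvPolynomial (Fin 3) ℂ) : zetaPolyEval z₀ Q g z = zetaPolyEval z₀ Q g' z := by
  unfold zetaPolyEval
  congr 2
  funext i
  fin_cases i <;> simp [h]

/-- A continuation `g` to the disc of radius `δ` around `w` of a solution of the differential
equation with coefficients `p`, which still satisfies, along with the zeta function and `f`, the
polynomial relation with coefficients `A`. -/
def RelationContinues (p : ℕ → Polynomial ℂ) (r : ℕ) (f : ℂ → ℂ) (z₀ : ℂ)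
    (A : ℕ → MvPolynomial (Fin 3) ℂ) (N j₀ : ℕ) (δ : ℝ) (w : ℂ) : Prop :=
  ∃ g : ℂ → ℂ, AnalyticOnNhd ℂ g (Metric.ball w δ) ∧
    (∀ᶠ z in 𝓝 w, ∑ i ∈ Finset.range (r + 1), (p i).eval z * iteratedDeriv i g z = 0) ∧
    (∀ᶠ z in 𝓝[≠] w, ∑ j ∈ Finset.range (N + 1), zetaPolyEval z₀ (A j) g z * f z ^ j = 0) ∧
    ¬ ∀ᶠ z in 𝓝 w, zetaPolyEval z₀ (A j₀) g z = 0

section Continuation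

variable {p : ℕ → Polynomial ℂ} {r : ℕ} {f : ℂ → ℂ} {z₀ : ℂ} {A : ℕ → MvPolynomial (Fin 3) ℂ}
  {N j₀ : ℕ} {δ : ℝ} {w w' : ℂ} {g : ℂ → ℂ}

theorem meromorphicOn_relation (hf : MeromorphicOn f (Metric.ball 0 1)) {U : Set ℂ}
    (hg : AnalyticOnNhd ℂ g U) (h1 : (1 : ℂ) ∉ U) :
    MeromorphicOn (fun z => ∑ j ∈ Finset.range (N + 1), zetaPolyEval z₀ (A j) g z * f z ^ j)
      (U ∩ Metric.ball 0 1) := by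
  intro z hz
  refine MeromorphicAt.fun_sum fun j _ => ?_
  have hz1 : z ≠ 1 := fun h => h1 (h ▸ hz.1)
  exact ((hg z hz.1).zetaPolyEval hz1 z₀ (A j)).meromorphicAt.mul ((hf z hz.2).pow j)

theorem relation_eventually (hf : MeromorphicOn f (Metric.ball 0 1))
    (h1 : (1 : ℂ) ∉ Metric.ball w δ) (hw : w ∈ Metric.ball (0 : ℂ) 1) (hδ : 0 < δ)
    (hg : AnalyticOnNhd ℂ g (Metric.ball w δ))
    (hrel : ∀ᶠ z in 𝓝[≠] w, ∑ j ∈ Finset.range (N + 1), zetaPolyEval z₀ (A j) g z * f z ^ j = 0) :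
    ∀ z ∈ Metric.ball w δ ∩ Metric.ball 0 1, ∀ᶠ z in 𝓝[≠] z,
      ∑ j ∈ Finset.range (N + 1), zetaPolyEval z₀ (A j) g z * f z ^ j = 0 := fun _ hz =>
  (meromorphicOn_relation hf hg h1).eventually_eq_zero_of_isPreconnected
    ((convex_ball w δ).inter (convex_ball 0 1)).isPreconnected ⟨Metric.mem_ball_self hδ, hw⟩ hz hrel

theorem not_eventually_zetaPolyEval_eq_zero (h1 : (1 : ℂ) ∉ Metric.ball w δ)
    (hg : AnalyticOnNhd ℂ g (Metric.ball w δ)) (hδ : 0 < δ)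
    (hne : ¬ ∀ᶠ z in 𝓝 w, zetaPolyEval z₀ (A j₀) g z = 0) (hw' : w' ∈ Metric.ball w δ) :
    ¬ ∀ᶠ z in 𝓝 w', zetaPolyEval z₀ (A j₀) g z = 0 := by
  intro h
  apply hne
  have han : AnalyticOnNhd ℂ (zetaPolyEval z₀ (A j₀) g) (Metric.ball w δ) := fun z hz =>
    (hg z hz).zetaPolyEval (fun h => h1 (h ▸ hz)) z₀ _
  have := han.eqOn_zero_of_preconnected_of_eventuallyEq_zero (convex_ball w δ).isPreconnected hw' h
  filter_upwards [Metric.ball_mem_nhds w hδ] with z hz using this hz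

/-- The solution is re-expanded at w'. The identity theorem, on the disc around w and on its convex
intersection with the unit disc, moves the differential equation, the nonvanishing and the relation
from w to w'. -/
theorem RelationContinues.step (hr : 0 < r) (hf : MeromorphicOn f (Metric.ball 0 1)) (hδ : 0 < δ)
    (hw : w ∈ Metric.ball (0 : ℂ) 1) (hw' : w' ∈ Metric.ball (0 : ℂ) 1)
    (hww' : w' ∈ Metric.ball w δ) (h1 : (1 : ℂ) ∉ Metric.ball w δ)
    (hp : ∀ z ∈ Metric.ball w' δ, (p r).eval z ≠ 0)
    (h : RelationContinues p r f z₀ A N j₀ δ w) : RelationContinues p r f z₀ A N j₀ δ w' := by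
  obtain ⟨g, hg, hode, hrel, hne⟩ := h
  have hode' : ∀ᶠ z in 𝓝 w',
      ∑ i ∈ Finset.range (r + 1), (p i).eval z * iteratedDeriv i g z = 0 := by
    have han : AnalyticOnNhd ℂ (fun z => ∑ i ∈ Finset.range (r + 1),
        (p i).eval z * iteratedDeriv i g z) (Metric.ball w δ) := fun z hz =>
      (HasTaylor.sum _ fun i _ => (HasTaylor.polynomial (p i)).mul
        ((hg z hz).hasTaylor.iteratedDeriv i)).1
    have := han.eqOn_zero_of_preconnected_of_eventuallyEq_zero (convex_ball w δ).isPreconnected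
      (Metric.mem_ball_self hδ) hode
    filter_upwards [Metric.isOpen_ball.mem_nhds hww'] with z hz using this hz
  obtain ⟨g', hg', heq⟩ := exists_analyticOnNhd_extension hr hδ hp (hg w' hww') hode'
  refine ⟨g', hg', ?_, ?_, ?_⟩
  · filter_upwards [hode', heq.eventually_nhds] with z hz hez
    rw [← hz]
    exact Finset.sum_congr rfl fun i _ => by rw [Filter.EventuallyEq.iteratedDeriv_eq i hez]
  · filter_upwards [relation_eventually hf h1 hw hδ hg hrel w' ⟨hww', hw'⟩,
      heq.filter_mono nhdsWithin_le_nhds] with z hz hez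
    rw [← hz]
    exact Finset.sum_congr rfl fun j _ => by rw [zetaPolyEval_congr hez]
  · intro hz
    apply not_eventually_zetaPolyEval_eq_zero h1 hg hδ hne hww'
    filter_upwards [hz, heq] with z hz hez
    rw [← hz, zetaPolyEval_congr hez]

theorem RelationContinues.algebraicAtBoundary (hf : MeromorphicOn f (Metric.ball 0 1)) (hδ : 0 < δ)
    (hw : w ∈ Metric.ball (0 : ℂ) 1) {ξ : ℂ} (hξ : ξ ∈ Metric.ball w δ)
    (h1 : (1 : ℂ) ∉ Metric.ball w δ) {j₀ : ℕ} (hj₀ : j₀ ≤ N)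
    (h : RelationContinues p r f z₀ A N j₀ δ w) : AlgebraicAtBoundary f ξ := by
  obtain ⟨g, hg, -, hrel, hne⟩ := h
  refine ⟨N, fun j => zetaPolyEval z₀ (A j) g, fun j =>
    (hg ξ hξ).zetaPolyEval (fun h => h1 (h ▸ hξ)) z₀ _,
    ⟨j₀, hj₀, not_eventually_zetaPolyEval_eq_zero h1 hg hδ hne hξ⟩, ?_⟩
  obtain ⟨ε, hε, hsub⟩ := Metric.isOpen_iff.mp Metric.isOpen_ball ξ hξ
  exact ⟨ε, hε, fun z hz => relation_eventually hf h1 hw hδ hg hrel z ⟨hsub hz.1, hz.2⟩⟩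

/-- A chain of discs whose centres are less than δ apart. The relation involves f and makes sense
only inside the unit disc, so the chain stops one step before ξ, which the last disc already
contains. -/
theorem RelationContinues.of_segment (hr : 0 < r) (hf : MeromorphicOn f (Metric.ball 0 1))
    (hδ : 0 < δ) {z₁ ξ : ℂ} (hz₁ : z₁ ∈ Metric.ball (0 : ℂ) 1) (hξ : ‖ξ‖ = 1)
    (hseg : ∀ w ∈ segment ℝ z₁ ξ, (1 : ℂ) ∉ Metric.ball w δ ∧
      ∀ z ∈ Metric.ball w δ, (p r).eval z ≠ 0)
    {j₀ : ℕ} (hj₀ : j₀ ≤ N)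
    (h : RelationContinues p r f z₀ A N j₀ δ z₁) : AlgebraicAtBoundary f ξ := by
  obtain ⟨n, hn⟩ := exists_nat_gt (‖ξ - z₁‖ / δ)
  have hn0 : (0 : ℝ) < n := lt_of_le_of_lt (by positivity) hn
  have hn0' : 0 < n := by exact_mod_cast hn0
  set γ : ℕ → ℂ := fun i => z₁ + ((i : ℝ) / n) • (ξ - z₁) with hγ
  have hγseg : ∀ i ≤ n, γ i ∈ segment ℝ z₁ ξ := fun i hi => by
    rw [segment_eq_image']
    exact ⟨(i : ℝ) / n, ⟨by positivity, by rw [div_le_one hn0]; exact_mod_cast hi⟩, rfl⟩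
  have hγball : ∀ i < n, γ i ∈ Metric.ball (0 : ℂ) 1 := fun i hi => by
    have hlt : (i : ℝ) / n < 1 := by rw [div_lt_one hn0]; exact_mod_cast hi
    have h0 : 0 ≤ (i : ℝ) / n := by positivity
    rw [mem_ball_zero_iff] at hz₁ ⊢
    have : γ i = (1 - (i : ℝ) / n) • z₁ + ((i : ℝ) / n) • ξ := by
      simp only [hγ, smul_sub, sub_smul, one_smul]; ring
    rw [this]
    refine (norm_add_le _ _).trans_lt ?_
    rw [norm_smul, norm_smul, hξ, Real.norm_of_nonneg h0, Real.norm_of_nonneg (by linarith)]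
    nlinarith [mul_lt_mul_of_pos_left hz₁ (sub_pos.mpr hlt)]
  have hγdist : ∀ i, γ (i + 1) ∈ Metric.ball (γ i) δ := fun i => by
    rw [Metric.mem_ball, dist_eq_norm]
    have : γ (i + 1) - γ i = ((1 : ℝ) / n) • (ξ - z₁) := by
      simp only [hγ, add_sub_add_left_eq_sub, ← sub_smul]
      congr 1
      push_cast
      ring
    rw [this, norm_smul, Real.norm_of_nonneg (by positivity), one_div_mul_eq_div, div_lt_iff₀ hn0]
    rwa [div_lt_iff₀ hδ, mul_comm] at hn
  have hcont : ∀ i < n, RelationContinues p r f z₀ A N j₀ δ (γ i) := by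
    intro i hi
    induction i with
    | zero => simpa [hγ] using h
    | succ i ih =>
      exact (ih (by omega)).step hr hf hδ (hγball i (by omega)) (hγball _ hi) (hγdist i)
        (hseg _ (hγseg i (by omega))).1 (hseg _ (hγseg _ hi.le)).2
  have hlast : γ (n - 1 + 1) = ξ := by
    rw [Nat.sub_add_cancel hn0']
    simp only [hγ]
    rw [div_self hn0.ne']
    simp
  refine (hcont (n - 1) (by omega)).algebraicAtBoundary hf hδ (hγball _ (by omega))
    (hlast ▸ hγdist (n - 1)) (hseg _ (hγseg _ (by omega))).1 hj₀

end Continuation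

/-- A point is hidden from an interior point of the unit disc by another given point only in
one direction. -/
theorem subsingleton_circle_of_mem_segment {z₁ s : ℂ} (hz₁ : ‖z₁‖ < 1) (hs : s ≠ z₁) :
    {ξ : ℂ | ‖ξ‖ = 1 ∧ s ∈ segment ℝ z₁ ξ}.Subsingleton := by
  have key : ∀ ξ ξ' : ℂ, ∀ a b : ℝ, ‖ξ‖ = 1 → ‖ξ'‖ = 1 → 0 < a → a ≤ b →
      a • (ξ - z₁) = b • (ξ' - z₁) → ξ = ξ' := by
    intro ξ ξ' a b hξ hξ' ha hab h
    have hb : 0 < b := ha.trans_le hab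
    rcases hab.eq_or_lt with rfl | hlt
    · have := smul_right_injective ℂ ha.ne' h
      simpa using this
    · exfalso
      have h1 : ξ' = (1 - a / b) • z₁ + (a / b) • ξ := by
        have h2 : ξ' - z₁ = (a / b) • (ξ - z₁) := by
          rw [div_eq_inv_mul, mul_smul, h, smul_smul, inv_mul_cancel₀ hb.ne', one_smul]
        rw [sub_smul, one_smul]
        rw [smul_sub] at h2
        linear_combination h2
      have hθ : a / b < 1 := by rwa [div_lt_one hb]
      have hθ0 : 0 < a / b := by positivity
      -- ξ' is a strict convex combination of the interior point z₁ and the boundary point ξ, so it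
      -- cannot be on the circle.
      have : ‖ξ'‖ < 1 := by
        rw [h1]
        refine (norm_add_le _ _).trans_lt ?_
        rw [norm_smul, norm_smul, hξ, Real.norm_of_nonneg hθ0.le,
          Real.norm_of_nonneg (by linarith)]
        nlinarith [mul_lt_mul_of_pos_left hz₁ (sub_pos.mpr hθ)]
      linarith
  rintro ξ ⟨hξ, h⟩ ξ' ⟨hξ', h'⟩
  rw [segment_eq_image'] at h h'
  obtain ⟨a, ha, rfl⟩ := h
  obtain ⟨b, hb, hab⟩ := h'
  have ha0 : a ≠ 0 := by rintro rfl; simp at hs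
  have hb0 : b ≠ 0 := by rintro rfl; simp at hab; exact hs (by simpa using hab)
  have heq : a • (ξ - z₁) = b • (ξ' - z₁) := (add_left_cancel hab).symm
  rcases le_total a b with hle | hle
  · exact key ξ ξ' a b hξ hξ' (lt_of_le_of_ne ha.1 ha0.symm) hle heq
  · exact (key ξ' ξ b a hξ' hξ (lt_of_le_of_ne hb.1 hb0.symm) hle heq.symm).symm

/-- If `f` is algebraic over `ℂ(z, G, ζ)` for a `D`-finite `G`, then it is algebraic over the
analytic germs at all but finitely many points of the unit circle. -/
theorem finite_not_algebraicAtBoundary {f : ℂ → ℂ} (hf : MeromorphicOn f (Metric.ball 0 1))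
    {z₀ : ℂ} (hz₀ : z₀ ∈ Metric.ball (0 : ℂ) 1) (hfz₀ : AnalyticAt ℂ f z₀)
    {G : ℂ → ℂ} (hG : IsDFiniteAt G z₀)
    (halg : IsAlgebraic (Algebra.adjoin ℂ {PowerSeries.X, taylorSeriesAt G z₀,
      taylorSeriesAt riemannZeta z₀}) (taylorSeriesAt f z₀)) :
    {ξ : ℂ | ‖ξ‖ = 1 ∧ ¬ AlgebraicAtBoundary f ξ}.Finite := by
  obtain ⟨r, p, hr, hp, hode⟩ := hG.exists_pos_order
  have hz₀1 : z₀ ≠ 1 := by rintro rfl; simp at hz₀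
  obtain ⟨P, hP, hPf⟩ := halg
  have hmem : ∀ j, ∃ Q : MvPolynomial (Fin 3) ℂ, MvPolynomial.aeval
      ![PowerSeries.X, taylorSeriesAt G z₀, taylorSeriesAt riemannZeta z₀] Q =
        (P.coeff j : PowerSeries ℂ) := by
    intro j
    have hset : ({PowerSeries.X, taylorSeriesAt G z₀, taylorSeriesAt riemannZeta z₀} :
        Set (PowerSeries ℂ)) = Set.range ![PowerSeries.X, taylorSeriesAt G z₀,
          taylorSeriesAt riemannZeta z₀] := by
      rw [Matrix.range_cons, Matrix.range_cons, Matrix.range_cons, Matrix.range_empty,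
        Set.union_empty, Set.singleton_union, Set.singleton_union]
    have hle := (congrArg (Algebra.adjoin ℂ) hset).trans (Algebra.adjoin_range_eq_range_aeval _ _)
    exact hle.le (P.coeff j).2
  choose A hA using hmem
  set N := P.natDegree with hN
  have hcoeff : ∀ j, HasTaylor (zetaPolyEval z₀ (A j) G) z₀ (P.coeff j : PowerSeries ℂ) := fun j =>
    hA j ▸ hG.1.hasTaylor.zetaPolyEval hz₀1 (A j)
  have hrel : ∀ᶠ z in 𝓝 z₀,
      ∑ j ∈ Finset.range (N + 1), zetaPolyEval z₀ (A j) G z * f z ^ j = 0 := by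
    rw [← (HasTaylor.sum _ fun j _ => (hcoeff j).mul (hfz₀.hasTaylor.pow j)).eq_zero_iff, ← hPf,
      Polynomial.aeval_eq_sum_range]
    rfl
  have hlead : ∀ᶠ z in 𝓝[≠] z₀, zetaPolyEval z₀ (A N) G z ≠ 0 := by
    rcases (hcoeff N).1.eventually_eq_zero_or_eventually_ne_zero with h | h
    · exfalso
      rw [← (hcoeff N).eq_zero_iff] at h
      exact hP (Polynomial.leadingCoeff_eq_zero.mp (Subtype.ext h))
    · exact h
  -- The factor X - 1 adds the pole of ζ to the singular points of the differential equation.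
  have hq : p r * (Polynomial.X - Polynomial.C 1) ≠ 0 :=
    mul_ne_zero hp (Polynomial.X_sub_C_ne_zero 1)
  set q := p r * (Polynomial.X - Polynomial.C 1) with hqdef
  -- z₀ itself may be a singular point or a zero of the leading coefficient; the continuation starts
  -- from a generic nearby point z₁.
  have hev : ∀ᶠ z in 𝓝[≠] z₀, AnalyticAt ℂ G z ∧
      (∀ᶠ w in 𝓝 z, ∑ i ∈ Finset.range (r + 1), (p i).eval w * iteratedDeriv i G w = 0) ∧
      (∀ᶠ w in 𝓝 z, ∑ j ∈ Finset.range (N + 1), zetaPolyEval z₀ (A j) G w * f w ^ j = 0) ∧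
      zetaPolyEval z₀ (A N) G z ≠ 0 ∧ q.eval z ≠ 0 ∧ z ∈ Metric.ball (0 : ℂ) 1 := by
    have hle : 𝓝[≠] z₀ ≤ 𝓝 z₀ := nhdsWithin_le_nhds
    filter_upwards [hG.1.eventually_analyticAt.filter_mono hle,
      hode.eventually_nhds.filter_mono hle, hrel.eventually_nhds.filter_mono hle, hlead,
      Polynomial.eventually_eval_ne_zero hq z₀,
      (Metric.isOpen_ball.eventually_mem hz₀).filter_mono hle] with z h1 h2 h3 h4 h5 h6
    exact ⟨h1, h2, h3, h4, h5, h6⟩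
  obtain ⟨z₁, hGz₁, hode₁, hrel₁, hlead₁, hqz₁, hz₁⟩ := hev.exists
  have hroots : (q.rootSet ℂ).Finite := q.rootSet_finite ℂ
  have hmemroot : ∀ z, z ∈ q.rootSet ℂ ↔ q.eval z = 0 := fun z => by
    rw [Polynomial.mem_rootSet]; simp [hq]
  -- The exceptional boundary points are those hidden from z₁ by a root of `q`, at most one for each
  -- root.
  have hfin : (⋃ s ∈ q.rootSet ℂ, {ξ : ℂ | ‖ξ‖ = 1 ∧ s ∈ segment ℝ z₁ ξ}).Finite := by
    refine hroots.biUnion fun s hs => (subsingleton_circle_of_mem_segment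
      (mem_ball_zero_iff.mp hz₁) ?_).finite
    rintro rfl
    exact hqz₁ ((hmemroot _).mp hs)
  refine hfin.subset ?_
  rintro ξ ⟨hξ, hnot⟩
  by_contra hξ'
  apply hnot
  have hdisj : segment ℝ z₁ ξ ⊆ (q.rootSet ℂ)ᶜ := by
    intro s hs hroot
    exact hξ' (Set.mem_biUnion hroot ⟨hξ, hs⟩)
  have hcomp : IsCompact (segment ℝ z₁ ξ) := by
    rw [segment_eq_image']
    exact isCompact_Icc.image (by fun_prop)
  obtain ⟨δ, hδ, hthick⟩ := hcomp.exists_thickening_subset_open hroots.isClosed.isOpen_compl hdisj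
  have hseg : ∀ w ∈ segment ℝ z₁ ξ, (1 : ℂ) ∉ Metric.ball w δ ∧
      ∀ z ∈ Metric.ball w δ, (p r).eval z ≠ 0 := by
    intro w hw
    have hball : ∀ z ∈ Metric.ball w δ, q.eval z ≠ 0 := fun z hz h =>
      hthick (Metric.mem_thickening_iff.mpr ⟨w, hw, hz⟩) ((hmemroot z).mpr h)
    exact ⟨fun h => hball 1 h (by simp [hqdef]), fun z hz h => hball z hz (by simp [hqdef, h])⟩
  refine RelationContinues.of_segment (A := A) (N := N) (z₀ := z₀) hr hf hδ hz₁ hξ hseg le_rfl ?_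
  obtain ⟨g, hg, heq⟩ := exists_analyticOnNhd_extension hr hδ
    (hseg z₁ (left_mem_segment ℝ z₁ ξ)).2 hGz₁ hode₁
  refine ⟨g, hg, ?_, ?_, ?_⟩
  · filter_upwards [hode₁, heq.eventually_nhds] with z hz hez
    rw [← hz]
    exact Finset.sum_congr rfl fun i _ => by rw [Filter.EventuallyEq.iteratedDeriv_eq i hez]
  · filter_upwards [hrel₁.filter_mono nhdsWithin_le_nhds,
      heq.filter_mono nhdsWithin_le_nhds] with z hz hez
    rw [← hz]
    exact Finset.sum_congr rfl fun j _ => by rw [zetaPolyEval_congr hez]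
  · intro h
    exact hlead₁ (by rw [← zetaPolyEval_congr heq.self_of_nhds]; exact h.self_of_nhds)

/-! ### Mahler equations as identities on the unit disc. -/

theorem HasTaylor.comp_pow {f : ℂ → ℂ} {φ : PowerSeries ℂ} (hf : HasTaylor f 0 φ) {m : ℕ}
    (hm : m ≠ 0) : HasTaylor (fun z => f (z ^ m)) 0 (φ.subst (PowerSeries.X ^ m)) := by
  have hpow0 : (0 : ℂ) ^ m = 0 := zero_pow hm
  have han : AnalyticAt ℂ (fun z => f (z ^ m)) 0 :=
    AnalyticAt.fun_comp (g := f) (f := fun z : ℂ => z ^ m) (by simpa [hpow0] using hf.1)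
      (analyticAt_id.pow m)
  refine ⟨han, ?_⟩
  set b : ℕ → ℂ := fun n => PowerSeries.coeff n (φ.subst (PowerSeries.X ^ m)) with hb
  have hb1 : ∀ n, b (m * n) = PowerSeries.coeff n φ := fun n => by
    rw [hb, ← PowerSeries.expand_apply m hm]
    simp [PowerSeries.coeff_expand, Nat.mul_div_cancel_left n (Nat.pos_of_ne_zero hm)]
  have hb2 : ∀ n, n ∉ Set.range (fun i => m * i) → b n = 0 := fun n hn => by
    rw [hb, ← PowerSeries.expand_apply m hm]
    simp only [PowerSeries.coeff_expand]
    rw [if_neg]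
    rintro ⟨c, rfl⟩
    exact hn ⟨c, rfl⟩
  have hinj : Function.Injective (fun i => m * i) := fun i j h =>
    Nat.eq_of_mul_eq_mul_left (Nat.pos_of_ne_zero hm) h
  have h1 := hasFPowerSeriesAt_iff.mp hf.1.hasFPowerSeriesAt
  have htend : Tendsto (fun z : ℂ => z ^ m) (𝓝 0) (𝓝 0) := by
    have := (continuous_pow m).tendsto (0 : ℂ)
    rwa [hpow0] at this
  have h2 : HasFPowerSeriesAt (fun z => f (z ^ m)) (FormalMultilinearSeries.ofScalars ℂ b) 0 := by
    rw [hasFPowerSeriesAt_iff]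
    filter_upwards [htend.eventually h1] with z hz
    rw [zero_add] at hz ⊢
    rw [← hinj.hasSum_iff]
    · convert hz using 2 with n
      simp only [Function.comp, FormalMultilinearSeries.coeff_ofScalars]
      rw [hb1, hf.coeff, pow_mul]
    · intro n hn
      simp only [FormalMultilinearSeries.coeff_ofScalars]
      rw [hb2 n hn, smul_zero]
  have h3 := h2.eq_formalMultilinearSeries han.hasFPowerSeriesAt
  ext n
  rw [taylorSeriesAt, PowerSeries.coeff_mk]
  have h4 := congrArg (fun P => FormalMultilinearSeries.coeff P n) h3
  simp only [FormalMultilinearSeries.coeff_ofScalars] at h4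
  exact h4.symm

/-- The identity of power series holds near 0 and spreads by the identity theorem for meromorphic
functions. Neighbourhoods are punctured because the values of f at its poles are arbitrary. -/
theorem MahlerEquation.eventually_eq_zero {k d : ℕ} (hk : 2 ≤ k) {a : ℕ → Polynomial ℂ}
    {F : PowerSeries ℂ} (h : MahlerEquation k d a F) {f : ℂ → ℂ}
    (hf : IsMeromorphicRealization F f) : ∀ z ∈ Metric.ball (0 : ℂ) 1, ∀ᶠ w in 𝓝[≠] z,
      ∑ i ∈ Finset.range (d + 1), (a i).eval w * f (w ^ k ^ i) = 0 := by
  intro z hz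
  have hF : HasTaylor f 0 F := ⟨hf.analyticAt_zero, hf.taylor⟩
  have hne : ∀ i, k ^ i ≠ 0 := fun i => pow_ne_zero _ (by omega)
  have hsum : HasTaylor (fun w => ∑ i ∈ Finset.range (d + 1), (a i).eval w * f (w ^ k ^ i)) 0 0 := by
    rw [← h.2]
    refine HasTaylor.sum _ fun i _ => ?_
    have := HasTaylor.polynomial (z₀ := 0) (a i)
    rw [map_zero, add_zero, Polynomial.comp_X] at this
    exact this.mul (hF.comp_pow (hne i))
  refine MeromorphicOn.eventually_eq_zero_of_isPreconnected (U := Metric.ball 0 1) ?_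
    (convex_ball _ _).isPreconnected (Metric.mem_ball_self one_pos) hz
    (hsum.eventually_eq_zero.filter_mono nhdsWithin_le_nhds)
  intro w hw
  refine MeromorphicAt.fun_sum fun i _ => ?_
  refine (HasTaylor.polynomial (z₀ := w) (a i)).1.meromorphicAt.mul ?_
  refine MeromorphicAt.comp_analyticAt (g := fun w : ℂ => w ^ k ^ i) (f := f)
    (hf.meromorphicOn _ ?_) (analyticAt_id.pow _)
  rw [mem_ball_zero_iff] at hw ⊢
  rw [norm_pow]
  exact pow_lt_one₀ (norm_nonneg _) hw (hne i)

/-! ### Algebraicity over real-analytic germs along a radius. -/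

/-- The filter of sets containing, for all `t` close to `1` on the left, a punctured neighbourhood
of `t`. -/
def punctLeft : Filter ℝ := (𝓝[<] (1 : ℝ)).bind fun t => 𝓝[≠] t

theorem eventually_punctLeft {P : ℝ → Prop} :
    (∀ᶠ t in punctLeft, P t) ↔ ∀ᶠ t in 𝓝[<] (1 : ℝ), ∀ᶠ s in 𝓝[≠] t, P s :=
  Filter.eventually_bind

/-- The filter is finer because (-∞, 1) is open. The finer filter is needed since poles of f may
accumulate at 1, and relations involving f are only known off a discrete set. -/
theorem punctLeft_le : punctLeft ≤ 𝓝[<] (1 : ℝ) := by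
  intro s hs
  refine eventually_punctLeft.mpr ?_
  have h1 := eventually_eventually_nhdsWithin.mpr (Filter.eventually_mem_set.mpr hs)
  filter_upwards [h1, self_mem_nhdsWithin] with t ht ht1
  rw [isOpen_Iio.nhdsWithin_eq ht1] at ht
  exact ht.filter_mono nhdsWithin_le_nhds

instance punctLeft_neBot : punctLeft.NeBot := by
  refine ⟨fun h => ?_⟩
  have : ∀ᶠ t in punctLeft, False := by rw [h]; exact Filter.eventually_bot
  obtain ⟨t, ht⟩ := (eventually_punctLeft.mp this).exists
  exact ht.exists.elim fun _ h => h

theorem punctLeft_le_nhdsNE : punctLeft ≤ 𝓝[≠] (1 : ℝ) :=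
  punctLeft_le.trans (nhdsWithin_mono _ fun _ h => ne_of_lt h)

theorem AnalyticAt.eventually_punctLeft_ne_zero {h : ℝ → ℂ} (hh : AnalyticAt ℝ h 1)
    (h0 : ¬ ∀ᶠ t in 𝓝 (1 : ℝ), h t = 0) : ∀ᶠ t in punctLeft, h t ≠ 0 :=
  (hh.eventually_eq_zero_or_eventually_ne_zero.resolve_left h0).filter_mono punctLeft_le_nhdsNE

/-- Germs, along `punctLeft`, of functions which are real-analytic at `1`. -/
def analyticGerms : Subring (punctLeft.Germ ℂ) where
  carrier := {x | ∃ h : ℝ → ℂ, AnalyticAt ℝ h 1 ∧ (h : punctLeft.Germ ℂ) = x}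
  mul_mem' := by
    rintro _ _ ⟨g, hg, rfl⟩ ⟨h, hh, rfl⟩
    exact ⟨g * h, hg.mul hh, rfl⟩
  one_mem' := ⟨1, analyticAt_const, rfl⟩
  add_mem' := by
    rintro _ _ ⟨g, hg, rfl⟩ ⟨h, hh, rfl⟩
    exact ⟨g + h, hg.add hh, rfl⟩
  zero_mem' := ⟨0, analyticAt_const, rfl⟩
  neg_mem' := by
    rintro _ ⟨g, hg, rfl⟩
    exact ⟨-g, hg.neg, rfl⟩

/-- The element of `analyticGerms` defined by a function. -/
def AnalyticAt.toGerm {h : ℝ → ℂ} (hh : AnalyticAt ℝ h 1) : analyticGerms :=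
  ⟨(h : punctLeft.Germ ℂ), h, hh, rfl⟩

theorem AnalyticAt.toGerm_eq_zero {h : ℝ → ℂ} (hh : AnalyticAt ℝ h 1) :
    hh.toGerm = 0 ↔ ∀ᶠ t in 𝓝 (1 : ℝ), h t = 0 := by
  have h1 : hh.toGerm = 0 ↔ ∀ᶠ t in punctLeft, h t = 0 := by
    rw [Subtype.ext_iff]
    exact Filter.Germ.coe_eq
  rw [h1]
  constructor
  · intro h0
    by_contra hne
    obtain ⟨t, ht, ht'⟩ := (h0.and (hh.eventually_punctLeft_ne_zero hne)).exists
    exact ht' ht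
  · intro h0
    exact h0.filter_mono (punctLeft_le.trans nhdsWithin_le_nhds)

/-- Nonzero analytic germs have isolated zeros, so two of them are nonzero together along the
filter. -/
instance : NoZeroDivisors analyticGerms where
  eq_zero_or_eq_zero_of_mul_eq_zero := by
    rintro ⟨_, g, hg, rfl⟩ ⟨_, h, hh, rfl⟩ hgh
    have h1 : (hg.mul hh).toGerm = 0 := hgh
    rw [AnalyticAt.toGerm_eq_zero] at h1
    change hg.toGerm = 0 ∨ hh.toGerm = 0
    rw [hg.toGerm_eq_zero, hh.toGerm_eq_zero]
    by_contra hne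
    rw [not_or] at hne
    obtain ⟨t, ht, ht1, ht2⟩ := ((h1.filter_mono (punctLeft_le.trans nhdsWithin_le_nhds)).and
      ((hg.eventually_punctLeft_ne_zero hne.1).and (hh.eventually_punctLeft_ne_zero hne.2))).exists
    exact (mul_ne_zero ht1 ht2) ht

/-- `u` is algebraic over the germs at `1` of real-analytic functions. -/
def AlgebraicLeft (u : ℝ → ℂ) : Prop := IsAlgebraic analyticGerms (u : punctLeft.Germ ℂ)

theorem algebraicLeft_iff {u : ℝ → ℂ} : AlgebraicLeft u ↔
    ∃ (N : ℕ) (h : ℕ → ℝ → ℂ), (∀ j, AnalyticAt ℝ (h j) 1) ∧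
      (∃ j ≤ N, ¬ ∀ᶠ t in 𝓝 (1 : ℝ), h j t = 0) ∧
      ∀ᶠ t in punctLeft, ∑ j ∈ Finset.range (N + 1), h j t * u t ^ j = 0 := by
  have hsum : ∀ (s : Finset ℕ) (g : ℕ → ℝ → ℂ),
      ((fun t => ∑ j ∈ s, g j t : ℝ → ℂ) : punctLeft.Germ ℂ) =
        ∑ j ∈ s, (g j : punctLeft.Germ ℂ) := by
    intro s g
    induction s using Finset.induction_on with
    | empty => rfl
    | insert a s ha ih => rw [Finset.sum_insert ha, ← ih]; simp only [Finset.sum_insert ha]; rfl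
  constructor
  · rintro ⟨P, hP, hPu⟩
    have hc : ∀ j, ∃ h : ℝ → ℂ, ∃ hh : AnalyticAt ℝ h 1, hh.toGerm = P.coeff j := fun j => by
      obtain ⟨h, hh, heq⟩ := (P.coeff j).2
      exact ⟨h, hh, Subtype.ext heq⟩
    choose h hh heq using hc
    refine ⟨P.natDegree, h, hh, ⟨P.natDegree, le_rfl, ?_⟩, ?_⟩
    · rw [← (hh _).toGerm_eq_zero, heq]
      exact Polynomial.leadingCoeff_ne_zero.mpr hP
    · rw [Polynomial.aeval_eq_sum_range] at hPu
      have h0 : ((fun t => ∑ j ∈ Finset.range (P.natDegree + 1), h j t * u t ^ j : ℝ → ℂ) :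
          punctLeft.Germ ℂ) = ((0 : ℝ → ℂ) : punctLeft.Germ ℂ) := ?_
      · exact Filter.Germ.coe_eq.mp h0
      rw [hsum]
      refine Eq.trans (Finset.sum_congr rfl fun j _ => ?_) hPu
      rw [← heq]
      rfl
  · rintro ⟨N, h, hh, ⟨j₀, hj₀, hne⟩, hrel⟩
    refine ⟨∑ j ∈ Finset.range (N + 1), Polynomial.C (hh j).toGerm * Polynomial.X ^ j, ?_, ?_⟩
    · intro h0
      have := congrArg (fun P => Polynomial.coeff P j₀) h0
      simp only [Polynomial.finsetSum_coeff, Polynomial.coeff_C_mul_X_pow,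
        Polynomial.coeff_zero] at this
      rw [Finset.sum_ite_eq, if_pos (Finset.mem_range.mpr (by omega))] at this
      exact hne ((hh j₀).toGerm_eq_zero.mp this)
    · have h1 : ((fun t => ∑ j ∈ Finset.range (N + 1), h j t * u t ^ j : ℝ → ℂ) :
          punctLeft.Germ ℂ) = 0 := Filter.Germ.coe_eq.mpr hrel
      rw [hsum] at h1
      rw [map_sum, ← h1]
      refine Finset.sum_congr rfl fun j _ => ?_
      rw [map_mul, Polynomial.aeval_C, map_pow, Polynomial.aeval_X]
      rfl

theorem AlgebraicLeft.congr {u v : ℝ → ℂ} (hu : AlgebraicLeft u) (h : u =ᶠ[punctLeft] v) :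
    AlgebraicLeft v := by
  unfold AlgebraicLeft at hu ⊢
  rwa [← Filter.Germ.coe_eq.mpr h]

theorem AlgebraicLeft.comp {u : ℝ → ℂ} (hu : AlgebraicLeft u) {φ : ℝ → ℝ} (hφ : AnalyticAt ℝ φ 1)
    (h1 : φ 1 = 1) (htend : Tendsto φ punctLeft punctLeft) : AlgebraicLeft (fun t => u (φ t)) := by
  obtain ⟨N, h, hh, ⟨j₀, hj₀, hne⟩, hrel⟩ := algebraicLeft_iff.mp hu
  refine algebraicLeft_iff.mpr ⟨N, fun j t => h j (φ t), fun j => ?_, ⟨j₀, hj₀, fun h0 => ?_⟩,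
    htend.eventually hrel⟩
  · exact AnalyticAt.fun_comp (g := h j) (f := φ) (by rw [h1]; exact hh j) hφ
  · obtain ⟨t, ht, ht'⟩ := ((h0.filter_mono (punctLeft_le.trans nhdsWithin_le_nhds)).and
      (htend.eventually ((hh j₀).eventually_punctLeft_ne_zero hne))).exists
    exact ht' ht

/-- Injectivity keeps punctured neighbourhoods punctured. -/
theorem tendsto_punctLeft {φ : ℝ → ℝ} (hc : ContinuousOn φ (Set.Ioo 0 1))
    (hi : Set.InjOn φ (Set.Ioo 0 1)) (ht : Tendsto φ (𝓝[<] 1) (𝓝[<] 1)) :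
    Tendsto φ punctLeft punctLeft := by
  intro s hs
  refine eventually_punctLeft.mpr ?_
  have h1 := ht.eventually (eventually_punctLeft.mp hs)
  filter_upwards [h1, Ioo_mem_nhdsLT (zero_lt_one' ℝ)] with t ht1 ht2
  have htend : Tendsto φ (𝓝[≠] t) (𝓝[≠] (φ t)) := by
    refine tendsto_nhdsWithin_iff.mpr ⟨((hc t ht2).continuousAt
      (isOpen_Ioo.mem_nhds ht2)).tendsto.mono_left nhdsWithin_le_nhds, ?_⟩
    filter_upwards [self_mem_nhdsWithin, mem_nhdsWithin_of_mem_nhds (isOpen_Ioo.mem_nhds ht2)]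
      with x hx hx1 heq
    exact hx (hi hx1 ht2 heq)
  exact htend.eventually ht1

theorem tendsto_rpow_punctLeft {c : ℝ} (hc : 0 < c) :
    Tendsto (fun t : ℝ => t ^ c) punctLeft punctLeft := by
  refine tendsto_punctLeft ?_ ?_ ?_
  · exact fun t ht => (Real.continuousAt_rpow_const t c (Or.inl ht.1.ne')).continuousWithinAt
  · intro x hx y hy hxy
    exact (Real.rpow_left_inj hx.1.le hy.1.le hc.ne').mp hxy
  · refine tendsto_nhdsWithin_iff.mpr ⟨?_, ?_⟩
    · have := (Real.continuousAt_rpow_const 1 c (Or.inl one_ne_zero)).tendsto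
      rw [Real.one_rpow] at this
      exact this.mono_left nhdsWithin_le_nhds
    · filter_upwards [Ioo_mem_nhdsLT (zero_lt_one' ℝ)] with t ht
      exact Real.rpow_lt_one ht.1.le ht.2 hc

theorem algebraicLeft_comp_rpow {u : ℝ → ℂ} {c : ℝ} (hc : 0 < c) (hu : AlgebraicLeft u) :
    AlgebraicLeft (fun t => u (t ^ c)) := by
  refine hu.comp ?_ (Real.one_rpow c) (tendsto_rpow_punctLeft hc)
  refine ((analyticAt_log one_pos).mul (analyticAt_const (v := c))).rexp.congr ?_
  filter_upwards [Ioi_mem_nhds (zero_lt_one' ℝ)] with t ht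
  exact (Real.rpow_def_of_pos ht c).symm

/-- t ↦ t^m is an analytic change of parameter at 1, with inverse t^(1/m). This absorbs the powers
z^(k^i) of a Mahler equation. -/
theorem algebraicLeft_comp_pow_iff {u : ℝ → ℂ} {m : ℕ} (hm : m ≠ 0) :
    AlgebraicLeft (fun t => u (t ^ m)) ↔ AlgebraicLeft u := by
  have hm' : (0 : ℝ) < m := by exact_mod_cast Nat.pos_of_ne_zero hm
  constructor
  · intro h
    refine (algebraicLeft_comp_rpow (inv_pos.mpr hm') h).congr ?_
    filter_upwards [punctLeft_le (Ioo_mem_nhdsLT (zero_lt_one' ℝ))] with t ht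
    rw [Real.rpow_inv_natCast_pow ht.1.le hm]
  · intro h
    simpa using algebraicLeft_comp_rpow hm' h

theorem tendsto_mul_nhdsNE {ξ : ℂ} (hξ : ξ ≠ 0) (t : ℝ) :
    Tendsto (fun s : ℝ => (s : ℂ) * ξ) (𝓝[≠] t) (𝓝[≠] ((t : ℂ) * ξ)) := by
  refine tendsto_nhdsWithin_iff.mpr ⟨?_, ?_⟩
  · exact (Continuous.tendsto (by fun_prop) t).mono_left nhdsWithin_le_nhds
  · filter_upwards [self_mem_nhdsWithin] with s hs h
    exact hs (by exact_mod_cast mul_right_cancel₀ hξ h)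

theorem analyticAt_comp_ray {h : ℂ → ℂ} {ξ : ℂ} (hh : AnalyticAt ℂ h ξ) :
    AnalyticAt ℝ (fun t : ℝ => h ((t : ℂ) * ξ)) 1 := by
  refine AnalyticAt.fun_comp (g := h) (f := fun t : ℝ => (t : ℂ) * ξ)
    (by simpa using hh.restrictScalars (𝕜 := ℝ)) ?_
  exact (Complex.ofRealCLM.analyticAt 1).mul analyticAt_const

theorem not_eventually_comp_ray {h : ℂ → ℂ} {ξ : ℂ} (hξ : ξ ≠ 0) (hh : AnalyticAt ℂ h ξ)
    (hne : ¬ ∀ᶠ z in 𝓝 ξ, h z = 0) : ¬ ∀ᶠ t : ℝ in 𝓝 1, h ((t : ℂ) * ξ) = 0 := by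
  intro h0
  have h1 := hh.eventually_eq_zero_or_eventually_ne_zero.resolve_left hne
  have h2 := tendsto_mul_nhdsNE hξ 1
  rw [Complex.ofReal_one, one_mul] at h2
  obtain ⟨t, ht, ht'⟩ := ((h0.filter_mono nhdsWithin_le_nhds).and (h2.eventually h1)).exists
  exact ht' ht

theorem AlgebraicAtBoundary.algebraicLeft {f : ℂ → ℂ} {ξ : ℂ} (hξ : ‖ξ‖ = 1)
    (h : AlgebraicAtBoundary f ξ) : AlgebraicLeft (fun t => f ((t : ℂ) * ξ)) := by
  obtain ⟨N, h, hh, ⟨j₀, hj₀, hne⟩, ε, hε, hrel⟩ := h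
  have hξ0 : ξ ≠ 0 := by rintro rfl; simp at hξ
  refine algebraicLeft_iff.mpr ⟨N, fun j t => h j ((t : ℂ) * ξ), fun j => analyticAt_comp_ray (hh j),
    ⟨j₀, hj₀, not_eventually_comp_ray hξ0 (hh j₀) hne⟩, ?_⟩
  rw [eventually_punctLeft]
  have htend : Tendsto (fun t : ℝ => (t : ℂ) * ξ) (𝓝 1) (𝓝 ξ) := by
    have : Continuous (fun t : ℝ => (t : ℂ) * ξ) := by fun_prop
    simpa using this.tendsto 1
  filter_upwards [(htend.eventually (Metric.ball_mem_nhds ξ hε)).filter_mono nhdsWithin_le_nhds,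
    Ioo_mem_nhdsLT (zero_lt_one' ℝ)] with t ht ht1
  refine (tendsto_mul_nhdsNE hξ0 t).eventually (hrel _ ⟨ht, ?_⟩)
  rw [mem_ball_zero_iff, norm_mul, hξ, mul_one, Complex.norm_real, Real.norm_of_nonneg ht1.1.le]
  exact ht1.2

/-! ### Propagation by the Mahler equation to the radius ending at 1. -/

/-- In the presence of a Mahler equation, algebraicity along the radii to `ξ ^ k ^ i`, `i < d`,
propagates to the radius to `ξ ^ k ^ d`. -/
theorem algebraicLeft_step {k d : ℕ} (hk : 2 ≤ k) {a : ℕ → Polynomial ℂ} {f : ℂ → ℂ}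
    (had : a d ≠ 0) (hrel : ∀ z ∈ Metric.ball (0 : ℂ) 1, ∀ᶠ w in 𝓝[≠] z,
      ∑ i ∈ Finset.range (d + 1), (a i).eval w * f (w ^ k ^ i) = 0) {ξ : ℂ} (hξ : ‖ξ‖ = 1)
    (h : ∀ i < d, AlgebraicLeft (fun t => f ((t : ℂ) * ξ ^ k ^ i))) :
    AlgebraicLeft (fun t => f ((t : ℂ) * ξ ^ k ^ d)) := by
  have hξ0 : ξ ≠ 0 := by rintro rfl; simp at hξ
  have hne : ∀ i, k ^ i ≠ 0 := fun i => pow_ne_zero _ (by omega)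
  -- Since (tξ)^(k^i) = t^(k^i) ξ^(k^i), `v i` is f along the radius to ξ^(k^i), up to a change of
  -- parameter.
  set v : ℕ → ℝ → ℂ := fun i t => f (((t : ℂ) * ξ) ^ k ^ i) with hv
  have hval : ∀ i, AlgebraicLeft (v i) ↔ AlgebraicLeft (fun t => f ((t : ℂ) * ξ ^ k ^ i)) := by
    intro i
    rw [← algebraicLeft_comp_pow_iff (u := fun t => f ((t : ℂ) * ξ ^ k ^ i)) (hne i)]
    simp only [hv, mul_pow, Complex.ofReal_pow]
  have hc : ∀ i, AnalyticAt ℝ (fun t : ℝ => (a i).eval ((t : ℂ) * ξ)) 1 := fun i =>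
    analyticAt_comp_ray (HasTaylor.polynomial (a i)).1
  have hev : ∀ᶠ t : ℝ in punctLeft,
      ∑ i ∈ Finset.range (d + 1), (a i).eval ((t : ℂ) * ξ) * v i t = 0 := by
    rw [eventually_punctLeft]
    filter_upwards [Ioo_mem_nhdsLT (zero_lt_one' ℝ)] with t ht1
    refine (tendsto_mul_nhdsNE hξ0 t).eventually (hrel _ ?_)
    rw [mem_ball_zero_iff, norm_mul, hξ, mul_one, Complex.norm_real, Real.norm_of_nonneg ht1.1.le]
    exact ht1.2
  have hsum : ∀ n ≤ d, AlgebraicLeft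
      (fun t => ∑ i ∈ Finset.range n, (a i).eval ((t : ℂ) * ξ) * v i t) := by
    intro n hn
    induction n with
    | zero =>
      have : AlgebraicLeft (fun _ => (0 : ℂ)) := isAlgebraic_zero (R := analyticGerms)
      simpa using this
    | succ n ih =>
      simp only [Finset.sum_range_succ]
      exact IsAlgebraic.add (ih (by omega))
        (IsAlgebraic.mul (isAlgebraic_algebraMap (hc n).toGerm) ((hval n).mpr (h n (by omega))))
  have hmul : AlgebraicLeft (fun t => (a d).eval ((t : ℂ) * ξ) * v d t) := by
    refine AlgebraicLeft.congr (u := fun t => -∑ i ∈ Finset.range d,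
      (a i).eval ((t : ℂ) * ξ) * v i t) (IsAlgebraic.neg (hsum d le_rfl)) ?_
    filter_upwards [hev] with t ht
    rw [Finset.sum_range_succ] at ht
    linear_combination -ht
  rw [← hval d]
  have hsmul : IsAlgebraic analyticGerms ((hc d).toGerm • (v d : punctLeft.Germ ℂ)) := hmul
  refine hsmul.of_smul (mem_nonZeroDivisors_of_ne_zero ?_)
  rw [Ne, (hc d).toGerm_eq_zero]
  exact not_eventually_comp_ray hξ0 (HasTaylor.polynomial (a d)).1
    (Polynomial.not_eventually_eval_eq_zero had ξ)

theorem infinite_rootsOfUnity_pow {k : ℕ} (hk : 2 ≤ k) :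
    {ξ : ℂ | ∃ n : ℕ, ξ ^ k ^ n = 1}.Infinite := by
  have hprim : ∀ n : ℕ, IsPrimitiveRoot (Complex.exp (2 * Real.pi * Complex.I / (k ^ n : ℕ))) (k ^ n) :=
    fun n => Complex.isPrimitiveRoot_exp _ (pow_ne_zero _ (by omega))
  refine Set.infinite_of_injective_forall_mem
    (f := fun n : ℕ => Complex.exp (2 * Real.pi * Complex.I / (k ^ n : ℕ))) ?_
    fun n => ⟨n, (hprim n).pow_eq_one⟩
  intro m n hmn
  have h1 := hprim m
  simp only at hmn
  rw [hmn] at h1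
  exact Nat.pow_right_injective hk (h1.unique (hprim n))

/-- A Mahler function which is algebraic over the analytic germs at all but finitely many points of
the unit circle is so along the radius to `1`. -/
theorem algebraicLeft_of_finite {k d : ℕ} (hk : 2 ≤ k) {a : ℕ → Polynomial ℂ} {f : ℂ → ℂ}
    (ha : ∃ i ≤ d, a i ≠ 0) (hrel : ∀ z ∈ Metric.ball (0 : ℂ) 1, ∀ᶠ w in 𝓝[≠] z,
      ∑ i ∈ Finset.range (d + 1), (a i).eval w * f (w ^ k ^ i) = 0)
    (hfin : {ξ : ℂ | ‖ξ‖ = 1 ∧ ¬ AlgebraicAtBoundary f ξ}.Finite) :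
    AlgebraicLeft (fun t => f t) := by
  classical
  -- q is the top index with a nonzero coefficient, so that the equation can be solved for
  -- f(z^(k^q)).
  obtain ⟨q, hqd, hq, hmax⟩ : ∃ q ≤ d, a q ≠ 0 ∧ ∀ i, q < i → i ≤ d → a i = 0 := by
    obtain ⟨i, hi, hai⟩ := ha
    have hspec := Nat.findGreatest_spec (P := fun i => a i ≠ 0) hi hai
    refine ⟨_, Nat.findGreatest_le d, hspec, fun i h1 h2 => ?_⟩
    by_contra h
    exact absurd (Nat.le_findGreatest (P := fun i => a i ≠ 0) h2 h) (by omega)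
  have hrel' : ∀ z ∈ Metric.ball (0 : ℂ) 1, ∀ᶠ w in 𝓝[≠] z,
      ∑ i ∈ Finset.range (q + 1), (a i).eval w * f (w ^ k ^ i) = 0 := by
    intro z hz
    filter_upwards [hrel z hz] with w hw
    rw [← hw]
    refine Finset.sum_subset (Finset.range_mono (by omega)) fun i hi hi' => ?_
    rw [Finset.mem_range] at hi hi'
    rw [hmax i (by omega) (by omega)]
    simp
  have hne : ∀ i, k ^ i ≠ 0 := fun i => pow_ne_zero _ (by omega)
  -- Power maps have finite fibres, so only finitely many ξ have an exceptional point among ξ, …,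
  -- ξ^(k^(q-1)).
  have hbad : (⋃ i ∈ Finset.range q, (fun ξ : ℂ => ξ ^ k ^ i) ⁻¹'
      {ξ : ℂ | ‖ξ‖ = 1 ∧ ¬ AlgebraicAtBoundary f ξ}).Finite := by
    refine (Finset.range q).finite_toSet.biUnion fun i _ => ?_
    refine hfin.preimage' fun c _ => ?_
    refine ((Polynomial.nthRoots (k ^ i) c).toFinset.finite_toSet).subset fun ξ hξ => ?_
    simpa [Polynomial.mem_nthRoots (Nat.pos_of_ne_zero (hne i))] using hξ
  obtain ⟨ξ, ⟨n, hξn⟩, hξ⟩ := (infinite_rootsOfUnity_pow hk).exists_notMem_finite hbad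
  have hnorm : ‖ξ‖ = 1 := by
    have : ‖ξ‖ ^ k ^ n = 1 := by rw [← norm_pow, hξn, norm_one]
    exact (pow_eq_one_iff_of_nonneg (norm_nonneg _) (hne n)).mp this
  -- The window of q consecutive iterates moves up by one at a time; for j = n it starts at ξ^(k^n)
  -- = 1.
  have hgood : ∀ j, ∀ i < q, AlgebraicLeft (fun t => f ((t : ℂ) * (ξ ^ k ^ j) ^ k ^ i)) := by
    intro j
    induction j with
    | zero =>
      intro i hi
      have h1 : ‖ξ ^ k ^ i‖ = 1 := by rw [norm_pow, hnorm, one_pow]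
      rw [pow_zero, pow_one]
      refine AlgebraicAtBoundary.algebraicLeft h1 ?_
      by_contra hbad'
      exact hξ (Set.mem_biUnion (Finset.mem_coe.mpr (Finset.mem_range.mpr hi)) ⟨h1, hbad'⟩)
    | succ j ih =>
      have hq' := algebraicLeft_step hk hq hrel'
        (by rw [norm_pow, hnorm, one_pow] : ‖ξ ^ k ^ j‖ = 1) ih
      intro i hi
      have heq : (ξ ^ k ^ (j + 1)) ^ k ^ i = (ξ ^ k ^ j) ^ k ^ (i + 1) := by
        rw [← pow_mul, ← pow_mul]; congr 1; ring
      rw [heq]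
      rcases Nat.lt_or_ge (i + 1) q with hlt | hge
      · exact ih (i + 1) hlt
      · rwa [show i + 1 = q by omega]
  -- One more step also covers q = 0, where the window is empty.
  have hfinal := algebraicLeft_step hk hq hrel'
    (by rw [norm_pow, hnorm, one_pow] : ‖ξ ^ k ^ n‖ = 1) (hgood n)
  simpa [hξn] using hfinal

/-! ### Exponential sums and the asymptotics at 1. -/

/-- Induction on the number of terms: x_(n+1) - u_a x_n removes the term of u_a and multiplies the
other coefficients by u_j - u_a ≠ 0. A single remaining term has constant modulus. -/
theorem eq_zero_of_tendsto_sum_mul_pow {ι : Type*} [DecidableEq ι] (s : Finset ι) {u : ι → ℂ}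
    (hu : ∀ j ∈ s, ‖u j‖ = 1) (hinj : Set.InjOn u s) :
    ∀ d : ι → ℂ, Tendsto (fun n : ℕ => ∑ j ∈ s, d j * u j ^ n) atTop (𝓝 0) → ∀ j ∈ s, d j = 0 := by
  induction s using Finset.induction_on with
  | empty => simp
  | insert a s ha ih =>
    intro d hd
    have hs : ∀ j ∈ s, d j = 0 := by
      have h1 : Tendsto (fun n : ℕ => ∑ j ∈ s, (d j * (u j - u a)) * u j ^ n) atTop (𝓝 0) := by
        have h2 := ((tendsto_add_atTop_iff_nat 1).mpr hd).sub (hd.const_mul (u a))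
        rw [mul_zero, sub_zero] at h2
        refine h2.congr fun n => ?_
        rw [Finset.sum_insert ha, Finset.sum_insert ha, mul_add, Finset.mul_sum,
          add_sub_add_comm, ← Finset.sum_sub_distrib]
        rw [show d a * u a ^ (n + 1) - u a * (d a * u a ^ n) = 0 by ring, zero_add]
        exact Finset.sum_congr rfl fun j _ => by ring
      intro j hj
      have h3 := ih (fun j hj => hu j (Finset.mem_insert_of_mem hj))
        (hinj.mono (by simp)) _ h1 j hj
      refine (mul_eq_zero.mp h3).resolve_right fun h => ha ?_
      have := hinj (by simp [hj]) (by simp) (sub_eq_zero.mp h)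
      rwa [← this]
    have h4 : Tendsto (fun n : ℕ => d a * u a ^ n) atTop (𝓝 0) := by
      refine hd.congr fun n => ?_
      rw [Finset.sum_insert ha, Finset.sum_eq_zero fun j hj => by rw [hs j hj, zero_mul], add_zero]
    have h5 : Tendsto (fun _ : ℕ => ‖d a‖) atTop (𝓝 0) := by
      have := h4.norm
      rw [norm_zero] at this
      refine this.congr fun n => ?_
      rw [norm_mul, norm_pow, hu a (by simp), one_pow, mul_one]
    intro j hj
    rcases Finset.mem_insert.mp hj with rfl | hj
    · exact norm_eq_zero.mp (tendsto_nhds_unique tendsto_const_nhds h5)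
    · exact hs j hj

/-- After division by the n-th power of the largest modulus, the smaller bases disappear in the
limit and the coefficients may be replaced by their limits; this leaves a sum over the unit circle.
-/
theorem false_of_sum_mul_pow_eq_zero {ι : Type*} [DecidableEq ι] {s : Finset ι} (hs : s.Nonempty)
    {v : ι → ℂ} (hv : ∀ j ∈ s, v j ≠ 0) (hinj : Set.InjOn v s) {D : ι → ℕ → ℂ} {d : ι → ℂ}
    (hD : ∀ j ∈ s, Tendsto (D j) atTop (𝓝 (d j))) (hd : ∀ j ∈ s, d j ≠ 0)
    (h : ∀ᶠ n in atTop, ∑ j ∈ s, D j n * v j ^ n = 0) : False := by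
  obtain ⟨j₀, hj₀, hmax⟩ := s.exists_max_image (fun j => ‖v j‖) hs
  set ρ := ‖v j₀‖ with hρ
  have hρ0 : 0 < ρ := norm_pos_iff.mpr (hv j₀ hj₀)
  have hρc : (ρ : ℂ) ≠ 0 := by exact_mod_cast hρ0.ne'
  set u : ι → ℂ := fun j => v j / ρ with hu
  have hnorm : ∀ j, ‖u j‖ = ‖v j‖ / ρ := fun j => by
    rw [hu]; simp only [norm_div, Complex.norm_real, Real.norm_of_nonneg hρ0.le]
  set S := s.filter fun j => ‖v j‖ = ρ with hS
  have hS1 : ∀ j ∈ S, ‖u j‖ = 1 := fun j hj => by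
    rw [hnorm, (Finset.mem_filter.mp hj).2, div_self hρ0.ne']
  have hSinj : Set.InjOn u S := fun i hi j hj hij =>
    hinj (Finset.mem_filter.mp hi).1 (Finset.mem_filter.mp hj).1 ((div_left_inj' hρc).mp hij)
  have hlim : ∀ j ∈ s, Tendsto (fun n => D j n * u j ^ n - if ‖v j‖ = ρ then d j * u j ^ n else 0)
      atTop (𝓝 0) := by
    intro j hj
    split_ifs with hjρ
    · have h1 : Tendsto (fun n => ‖D j n - d j‖) atTop (𝓝 0) := by
        simpa using ((hD j hj).sub_const (d j)).norm
      refine squeeze_zero_norm (fun n => ?_) h1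
      rw [← sub_mul, norm_mul, norm_pow, hnorm, hjρ, div_self hρ0.ne', one_pow, mul_one]
    · have hlt : ‖u j‖ < 1 := by
        rw [hnorm, div_lt_one hρ0]
        exact lt_of_le_of_ne (hmax j hj) hjρ
      simpa using (hD j hj).mul (tendsto_pow_atTop_nhds_zero_of_norm_lt_one hlt)
  have hsum : Tendsto (fun n => ∑ j ∈ S, d j * u j ^ n) atTop (𝓝 0) := by
    have h1 := (tendsto_finsetSum s hlim).neg
    simp only [Finset.sum_const_zero, neg_zero] at h1
    refine h1.congr' ?_
    filter_upwards [h] with n hn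
    rw [Finset.sum_sub_distrib, ← Finset.sum_filter]
    have : ∑ j ∈ s, D j n * u j ^ n = 0 := by
      have h2 : ∀ j, D j n * u j ^ n = D j n * v j ^ n / (ρ : ℂ) ^ n := fun j => by
        rw [hu]; simp only [div_pow]; ring
      simp only [h2]
      rw [← Finset.sum_div, hn, zero_div]
    rw [this, zero_sub, neg_neg]
  exact hd j₀ hj₀ (eq_zero_of_tendsto_sum_mul_pow S hS1 hSinj d hsum j₀
    (Finset.mem_filter.mpr ⟨hj₀, rfl⟩))

theorem tendsto_pow_mul_one_sub_exp {k : ℕ} (hk : 2 ≤ k) :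
    Tendsto (fun n : ℕ => (1 - Real.exp (-((k : ℝ) ^ n)⁻¹)) * (k : ℝ) ^ n) atTop (𝓝 1) := by
  have hk1 : (1 : ℝ) < k := by exact_mod_cast (by omega : 1 < k)
  have h1 : Tendsto (fun n : ℕ => -((k : ℝ) ^ n)⁻¹) atTop (𝓝[≠] 0) := by
    refine tendsto_nhdsWithin_iff.mpr ⟨?_, Eventually.of_forall fun n => ?_⟩
    · simpa using (tendsto_inv_atTop_zero.comp (tendsto_pow_atTop_atTop_of_one_lt hk1)).neg
    · have : (0 : ℝ) < (k : ℝ) ^ n := by positivity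
      simpa using this.ne'
  have h2 := (hasDerivAt_iff_tendsto_slope.mp (Real.hasDerivAt_exp 0)).comp h1
  rw [Real.exp_zero] at h2
  refine h2.congr fun n => ?_
  have : (0 : ℝ) < (k : ℝ) ^ n := by positivity
  simp only [Function.comp, slope_def_field, Real.exp_zero, sub_zero]
  field_simp
  ring

theorem inv_natPow_cpow_log_div_log {k : ℕ} (hk : 2 ≤ k) {l : ℂ} (hl : l ≠ 0) (n : ℕ) :
    ((((k : ℝ) ^ n)⁻¹ : ℝ) : ℂ) ^ (Complex.log l / (Real.log (k : ℝ) : ℂ)) = (l ^ n)⁻¹ := by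
  have hk1 : (1 : ℝ) < k := by exact_mod_cast (by omega : 1 < k)
  have hlog : (Real.log k : ℂ) ≠ 0 := by exact_mod_cast (Real.log_pos hk1).ne'
  have hpos : (0 : ℝ) < ((k : ℝ) ^ n)⁻¹ := by positivity
  rw [Complex.cpow_def_of_ne_zero (by exact_mod_cast hpos.ne'), ← Complex.ofReal_log hpos.le,
    Real.log_inv, Real.log_pow, ← Complex.exp_log hl, ← Complex.exp_nat_mul, ← Complex.exp_neg,
    Complex.exp_log hl]
  congr 1
  rw [Complex.ofReal_neg, Complex.ofReal_mul, Complex.ofReal_natCast]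
  field_simp

/-- A function with the asymptotic behaviour of a Mahler function whose eigenvalue is
multiplicatively independent of `k` is transcendental over the analytic germs at `1`. -/
theorem not_algebraicLeft_of_isEquivalent {k : ℕ} (hk : 2 ≤ k) {l : ℂ} (hl : l ≠ 0)
    (hindep : MultIndep (k : ℂ) l) {f : ℂ → ℂ} {C : ℝ → ℂ}
    (hC : ContinuousOn C (Set.Ioo 0 1)) (hC0 : ∀ t ∈ Set.Ioo (0 : ℝ) 1, C t ≠ 0)
    (hCk : ∀ t ∈ Set.Ioo (0 : ℝ) 1, C (t ^ k) = C t)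
    (hf : (fun t : ℝ => f (t : ℂ)) ~[𝓝[<] (1 : ℝ)]
        (fun t : ℝ => C t / ((1 - t : ℝ) : ℂ) ^ (Complex.log l / (Real.log (k : ℝ) : ℂ)))) :
    ¬ AlgebraicLeft (fun t => f t) := by
  classical
  intro halg
  obtain ⟨N, h, hh, ⟨j₀, hj₀, hne⟩, hrel⟩ := algebraicLeft_iff.mp halg
  set α := Complex.log l / (Real.log (k : ℝ) : ℂ) with hα
  have hk0 : (0 : ℝ) < k := by exact_mod_cast (by omega : 0 < k)
  have hkc : (k : ℂ) ≠ 0 := by exact_mod_cast (by omega : k ≠ 0)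
  have hk1 : (1 : ℝ) < k := by exact_mod_cast (by omega : 1 < k)
  -- τ_(n+1)^k = τ_n, so C is constant along the sequence, while 1 - τ_n is asymptotic to k^(-n).
  set τ : ℕ → ℝ := fun n => Real.exp (-((k : ℝ) ^ n)⁻¹) with hτ
  have hτmem : ∀ n, τ n ∈ Set.Ioo (0 : ℝ) 1 := fun n =>
    ⟨Real.exp_pos _, Real.exp_lt_one_iff.mpr (neg_lt_zero.mpr (by positivity))⟩
  have hτC : ∀ n, C (τ n) = C (τ 0) := by
    intro n
    induction n with
    | zero => rfl
    | succ n ih =>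
      rw [← ih, ← hCk _ (hτmem (n + 1))]
      congr 1
      simp only [hτ]
      rw [← Real.exp_nat_mul, pow_succ]
      congr 1
      field_simp
  have hpowinv : Tendsto (fun n : ℕ => ((k : ℝ) ^ n)⁻¹) atTop (𝓝 0) :=
    tendsto_inv_atTop_zero.comp (tendsto_pow_atTop_atTop_of_one_lt hk1)
  have hτlim : Tendsto τ atTop (𝓝[<] 1) := by
    refine tendsto_nhdsWithin_iff.mpr ⟨?_, Eventually.of_forall fun n => (hτmem n).2⟩
    have := (Real.continuous_exp.tendsto 0).comp (by simpa using hpowinv.neg :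
      Tendsto (fun n : ℕ => -((k : ℝ) ^ n)⁻¹) atTop (𝓝 0))
    rw [Real.exp_zero] at this
    exact this
  set rel : ℝ → Prop := fun t => ∑ j ∈ Finset.range (N + 1), h j t * f t ^ j = 0 with hreldef
  -- The relation may fail at τ_n itself, so τ_n is moved to a point with the same asymptotics. The
  -- last clause is conditional because its premise is known only for large n.
  have hex : ∀ n : ℕ, ∃ s : ℝ, s ∈ Set.Ioo (0 : ℝ) 1 ∧ ‖C s - C (τ 0)‖ < 1 / ((n : ℝ) + 1) ∧
      ‖(1 - s) * (k : ℝ) ^ n - (1 - τ n) * (k : ℝ) ^ n‖ < 1 / ((n : ℝ) + 1) ∧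
      ((∀ᶠ s in 𝓝[≠] (τ n), rel s) → rel s) := by
    intro n
    have hn : (0 : ℝ) < 1 / ((n : ℝ) + 1) := by positivity
    have h1 : ∀ᶠ s in 𝓝[≠] (τ n), s ∈ Set.Ioo (0 : ℝ) 1 :=
      mem_nhdsWithin_of_mem_nhds (isOpen_Ioo.mem_nhds (hτmem n))
    have h2 : ∀ᶠ s in 𝓝[≠] (τ n), ‖C s - C (τ 0)‖ < 1 / ((n : ℝ) + 1) := by
      have hc := (hC _ (hτmem n)).continuousAt (isOpen_Ioo.mem_nhds (hτmem n))
      have := (hc.sub_const (C (τ 0))).norm.eventually_lt_const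
        (u := 1 / ((n : ℝ) + 1)) (by rw [hτC n]; simpa using hn)
      exact this.filter_mono nhdsWithin_le_nhds
    have h3 : ∀ᶠ s in 𝓝[≠] (τ n),
        ‖(1 - s) * (k : ℝ) ^ n - (1 - τ n) * (k : ℝ) ^ n‖ < 1 / ((n : ℝ) + 1) := by
      have hc : ContinuousAt (fun s : ℝ => ‖(1 - s) * (k : ℝ) ^ n - (1 - τ n) * (k : ℝ) ^ n‖)
        (τ n) := by fun_prop
      exact (hc.eventually_lt_const (by simpa using hn)).filter_mono nhdsWithin_le_nhds
    by_cases hP : ∀ᶠ s in 𝓝[≠] (τ n), rel s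
    · obtain ⟨s, hs1, hs2, hs3, hs4⟩ := (h1.and (h2.and (h3.and hP))).exists
      exact ⟨s, hs1, hs2, hs3, fun _ => hs4⟩
    · obtain ⟨s, hs1, hs2, hs3⟩ := (h1.and (h2.and h3)).exists
      exact ⟨s, hs1, hs2, hs3, fun h => absurd h hP⟩
  choose s hs hsC hsu hsrel using hex
  have hone : Tendsto (fun n : ℕ => 1 / ((n : ℝ) + 1)) atTop (𝓝 0) :=
    tendsto_one_div_add_atTop_nhds_zero_nat
  have hClim : Tendsto (fun n => C (s n)) atTop (𝓝 (C (τ 0))) := by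
    rw [tendsto_iff_norm_sub_tendsto_zero]
    exact squeeze_zero (fun _ => norm_nonneg _) (fun n => (hsC n).le) hone
  set u : ℕ → ℝ := fun n => (1 - s n) * (k : ℝ) ^ n with hu
  have hulim : Tendsto u atTop (𝓝 1) := by
    have h1 : Tendsto (fun n => u n - (1 - τ n) * (k : ℝ) ^ n) atTop (𝓝 0) :=
      squeeze_zero_norm (fun n => (hsu n).le) hone
    have h2 := h1.add (tendsto_pow_mul_one_sub_exp hk)
    rw [zero_add] at h2
    exact h2.congr fun n => sub_add_cancel _ _
  have hkn : ∀ n : ℕ, (0 : ℝ) < (k : ℝ) ^ n := fun n => by positivity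
  have hsu' : ∀ n, 1 - s n = u n * ((k : ℝ) ^ n)⁻¹ := fun n => by
    simp only [hu]
    field_simp
  have hupos : ∀ n, 0 < u n := fun n => mul_pos (by linarith [(hs n).2]) (hkn n)
  have hslim : Tendsto s atTop (𝓝[<] 1) := by
    refine tendsto_nhdsWithin_iff.mpr ⟨?_, Eventually.of_forall fun n => (hs n).2⟩
    have h1 := (hulim.mul hpowinv).const_sub 1
    simp only [← hsu', mul_zero, sub_zero, sub_sub_cancel] at h1
    exact h1
  have hrels : ∀ᶠ n in atTop, rel (s n) := by
    filter_upwards [hτlim.eventually (eventually_punctLeft.mp hrel)] with n hn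
    exact hsrel n hn
  have hflim : Tendsto (fun n => f (s n) / l ^ n) atTop (𝓝 (C (τ 0))) := by
    obtain ⟨w, hw, hfw⟩ := hf.exists_eq_mul
    have hucpow : Tendsto (fun n => ((u n : ℝ) : ℂ) ^ α) atTop (𝓝 1) := by
      have hc : ContinuousAt (fun x : ℝ => (x : ℂ) ^ α) 1 :=
        Complex.continuousAt_ofReal_cpow_const 1 α (Or.inr one_ne_zero)
      have h1 := hc.tendsto.comp hulim
      rw [Complex.ofReal_one, Complex.one_cpow] at h1
      exact h1
    have h1 := ((hw.comp hslim).mul hClim).div hucpow one_ne_zero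
    rw [one_mul, div_one] at h1
    refine h1.congr' ?_
    filter_upwards [hslim.eventually hfw] with n hn
    rw [hn]
    simp only [Pi.mul_apply, Function.comp, Pi.div_apply]
    rw [hsu', Complex.ofReal_mul (u n), Complex.mul_cpow_ofReal_nonneg (hupos n).le
      (inv_pos.mpr (hkn n)).le, inv_natPow_cpow_log_div_log hk hl]
    have h2 : l ^ n ≠ 0 := pow_ne_zero _ hl
    have h3 : ((u n : ℝ) : ℂ) ^ α ≠ 0 := by
      rw [Ne, Complex.cpow_eq_zero_iff]
      rintro ⟨h, -⟩
      exact (hupos n).ne' (by exact_mod_cast h)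
    field_simp
  set J := (Finset.range (N + 1)).filter fun j => ¬ ∀ᶠ t in 𝓝 (1 : ℝ), h j t = 0 with hJ
  -- e is the order of the zero of `h j` at 1, so that `h j (s n)` · k^(ne) tends to (-1)^e g(1).
  have hfac : ∀ j, ∃ (e : ℕ) (g : ℝ → ℂ), j ∈ J → AnalyticAt ℝ g 1 ∧ g 1 ≠ 0 ∧
      ∀ᶠ t in 𝓝 (1 : ℝ), h j t = (t - 1) ^ e • g t := by
    intro j
    by_cases hj : j ∈ J
    · obtain ⟨e, g, hg⟩ := (hh j).exists_eventuallyEq_pow_smul_nonzero_iff.mpr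
        (Finset.mem_filter.mp hj).2
      exact ⟨e, g, fun _ => hg⟩
    · exact ⟨0, 0, fun h => absurd h hj⟩
  choose e g hg using hfac
  refine false_of_sum_mul_pow_eq_zero (s := J) (v := fun j => l ^ j / (k : ℂ) ^ e j)
    (D := fun j n => h j (s n) * ((k : ℂ) ^ n) ^ e j * (f (s n) / l ^ n) ^ j)
    (d := fun j => (-1) ^ e j * g j 1 * C (τ 0) ^ j)
    ⟨j₀, Finset.mem_filter.mpr ⟨Finset.mem_range.mpr (by omega), hne⟩⟩ ?_ ?_ ?_ ?_ ?_
  · exact fun j _ => div_ne_zero (pow_ne_zero _ hl) (pow_ne_zero _ hkc)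
  -- Equal bases give a multiplicative relation between k and l in which l has exponent i - j.
  · intro i _ j _ hij
    have h1 : (k : ℂ) ^ ((e j : ℤ) - e i) * l ^ ((i : ℤ) - j) = 1 := by
      rw [zpow_sub₀ hkc, zpow_sub₀ hl]
      simp only [zpow_natCast]
      have hki := pow_ne_zero (e i) hkc
      have hkj := pow_ne_zero (e j) hkc
      have hli := pow_ne_zero i hl
      have hlj := pow_ne_zero j hl
      simp only at hij
      rw [div_eq_div_iff hki hkj] at hij
      rw [div_mul_div_comm, div_eq_one_iff_eq (mul_ne_zero hki hlj)]
      linear_combination hij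
    have := (hindep _ _ h1).2
    omega
  · intro j hj
    obtain ⟨hga, hg1, hgh⟩ := hg j hj
    refine Tendsto.mul ?_ (hflim.pow j)
    have h1 : Tendsto (fun n => (-((u n : ℝ) : ℂ)) ^ e j * g j (s n)) atTop
        (𝓝 ((-1) ^ e j * g j 1)) := by
      have h2 : Tendsto (fun n => ((u n : ℝ) : ℂ)) atTop (𝓝 1) := by
        have := (Complex.continuous_ofReal.tendsto 1).comp hulim
        rw [Complex.ofReal_one] at this
        exact this
      exact (h2.neg.pow (e j)).mul
        (hga.continuousAt.tendsto.comp (hslim.mono_right nhdsWithin_le_nhds))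
    refine h1.congr' ?_
    filter_upwards [(hslim.mono_right nhdsWithin_le_nhds).eventually hgh] with n hn
    rw [hn, Complex.real_smul]
    have h3 : ((u n : ℝ) : ℂ) = (1 - (s n : ℂ)) * (k : ℂ) ^ n := by simp [hu]
    rw [h3]
    push_cast
    rw [show (-((1 - (s n : ℂ)) * (k : ℂ) ^ n)) = ((s n : ℂ) - 1) * (k : ℂ) ^ n by ring, mul_pow]
    ring
  · intro j hj
    exact mul_ne_zero (mul_ne_zero (pow_ne_zero _ (by norm_num)) (hg j hj).2.1)
      (pow_ne_zero _ (hC0 _ (hτmem 0)))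
  · have hzero : ∀ᶠ n in atTop, ∀ j ∈ Finset.range (N + 1), j ∉ J → h j (s n) = 0 := by
      rw [Filter.eventually_all_finset]
      intro j hj
      by_cases hjJ : j ∈ J
      · exact Eventually.of_forall fun n h => absurd hjJ h
      · have : ∀ᶠ t in 𝓝 (1 : ℝ), h j t = 0 := by
          by_contra hc
          exact hjJ (Finset.mem_filter.mpr ⟨hj, hc⟩)
        filter_upwards [(hslim.mono_right nhdsWithin_le_nhds).eventually this] with n hn _
        exact hn
    filter_upwards [hrels, hzero] with n hn hz
    rw [← hn]
    refine Eq.trans (Finset.sum_congr rfl fun j _ => ?_) (Finset.sum_subset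
      (Finset.filter_subset _ _) fun j hj hjJ => by rw [hz j hj hjJ, zero_mul])
    have h1 : (k : ℂ) ^ n ≠ 0 := pow_ne_zero _ hkc
    have h2 : l ^ n ≠ 0 := pow_ne_zero _ hl
    rw [div_pow, div_pow, ← pow_mul, ← pow_mul, ← pow_mul, ← pow_mul, mul_comm j n, mul_comm (e j) n]
    field_simp

/-! ### Assembling the three transcendence statements. -/

theorem IntermediateField.trdeg_adjoin_of_algebraicIndepOn.{u} {F E : Type u} [Field F]
    [Field E] [Algebra F E] {s : Set E} (hs : AlgebraicIndepOn F id s) :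
    Algebra.trdeg F (IntermediateField.adjoin F s) = Cardinal.mk s := by
  have e := AlgebraicIndependent.aevalEquivField hs
  rw [show Set.range (fun i : s => id (i : E)) = s by simp] at e
  have : Algebra.IsAlgebraic (MvPolynomial s F) (FractionRing (MvPolynomial s F)) :=
    IsLocalization.isAlgebraic _ (nonZeroDivisors (MvPolynomial s F))
  have h := trdeg_add_eq F (MvPolynomial s F) (A := FractionRing (MvPolynomial s F))
  rw [MvPolynomial.trdeg_of_isDomain, trdeg_eq_zero, add_zero, Cardinal.lift_id] at h
  rw [h]
  exact (e.trdeg_eq).symm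

/-- Algebraic independence of a family of three germs can be tested one germ at a time, over the
ring generated by the local coordinate and the previous power series. -/
theorem algebraicIndepOn_ratFunc_triple {f g h : PowerSeries ℂ}
    (hg : Transcendental (RatFunc ℂ) (g : LaurentSeries ℂ))
    (hh : Transcendental (Algebra.adjoin ℂ {PowerSeries.X, g}) h)
    (hf : Transcendental (Algebra.adjoin ℂ {PowerSeries.X, g, h}) f) :
    AlgebraicIndepOn (RatFunc ℂ) id ({(f : LaurentSeries ℂ), (g : LaurentSeries ℂ),
      (h : LaurentSeries ℂ)} : Set (LaurentSeries ℂ)) := by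
  -- Independence may be tested over polynomials, where the question descends from Laurent series to
  -- power series.
  have : Algebra.IsAlgebraic (Polynomial ℂ) (RatFunc ℂ) :=
    IsLocalization.isAlgebraic _ (nonZeroDivisors (Polynomial ℂ))
  refine (Algebra.IsAlgebraic.algebraicIndependent_iff (Polynomial ℂ) (RatFunc ℂ)).mp ?_
  have h0 : AlgebraicIndepOn (Polynomial ℂ) id {(g : LaurentSeries ℂ)} := by
    refine (algebraicIndependent_singleton_iff ⟨_, rfl⟩).mpr ?_
    exact hg.restrictScalars (FaithfulSMul.algebraMap_injective (Polynomial ℂ) (RatFunc ℂ))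
  have h1 : AlgebraicIndepOn (Polynomial ℂ) id {(h : LaurentSeries ℂ), (g : LaurentSeries ℂ)} := by
    refine h0.insert fun hc => hh ?_
    refine isAlgebraic_powerSeries_of_laurentSeries {g} h ?_
    rwa [Set.image_singleton] at hc ⊢
  refine AlgebraicIndepOn.insert (by rwa [Set.pair_comm]) fun hc => hf ?_
  refine isAlgebraic_powerSeries_of_laurentSeries {g, h} f ?_
  rwa [Set.image_pair] at hc ⊢

theorem IsDFiniteAt.transcendental_of_isMahlerEigenvalue {k : ℕ} (hk : 2 ≤ k) {F : PowerSeries ℂ}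
    (hF : IsMahler k F) {f : ℂ → ℂ} (hf : IsMeromorphicRealization F f) {l : ℂ}
    (hl : IsMahlerEigenvalue k F f l) (hindep : MultIndep (k : ℂ) l) {z₀ : ℂ}
    (hz₀ : z₀ ∈ Metric.ball (0 : ℂ) 1) (hfz₀ : AnalyticAt ℂ f z₀) {G : ℂ → ℂ}
    (hG : IsDFiniteAt G z₀) :
    Transcendental (Algebra.adjoin ℂ
      {PowerSeries.X, taylorSeriesAt G z₀, taylorSeriesAt riemannZeta z₀}) (taylorSeriesAt f z₀) := by
  intro halg
  obtain ⟨d, a, ha, hM⟩ := hF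
  obtain ⟨-, hl0, C, hC, ⟨c₁, c₂, hc₁, hCb⟩, hCk, hasymp⟩ := hl
  refine not_algebraicLeft_of_isEquivalent hk hl0 hindep hC.continuousOn (fun t ht h0 => ?_) hCk
    hasymp (algebraicLeft_of_finite hk ha (hM.eventually_eq_zero hk hf)
      (finite_not_algebraicAtBoundary hf.meromorphicOn hz₀ hfz₀ hG halg))
  have := (hCb t ht).1
  rw [h0, norm_zero] at this
  linarith

theorem mainTheorem9
    (k : ℕ) (hk : 2 ≤ k)
    (F : PowerSeries ℂ) (hF : IsMahler k F)
    (f : ℂ → ℂ) (hf : IsMeromorphicRealization F f)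
    (l : ℂ) (hl : IsMahlerEigenvalue k F f l)
    (hindep : MultIndep (k : ℂ) l)
    (z₀ : ℂ) (hz₀ : z₀ ∈ Metric.ball (0 : ℂ) 1) (hfz₀ : AnalyticAt ℂ f z₀)
    (G : ℂ → ℂ) (hG : IsDFiniteAt G z₀)
    (hGtr : Transcendental (RatFunc ℂ) (germAt G z₀)) :
    Algebra.trdeg (RatFunc ℂ)
      (IntermediateField.adjoin (RatFunc ℂ)
        ({germAt f z₀, germAt G z₀, germAt riemannZeta z₀} : Set (LaurentSeries ℂ))) = 3 := by
  have hz₁ : z₀ ≠ 1 := by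
    rintro rfl
    simp at hz₀
  have hζ := hG.transcendental_zeta hz₁
  have hftr := hG.transcendental_of_isMahlerEigenvalue hk hF hf hl hindep hz₀ hfz₀
  have hind := algebraicIndepOn_ratFunc_triple hGtr hζ hftr
  refine (IntermediateField.trdeg_adjoin_of_algebraicIndepOn hind).trans ?_
  have hinj : Function.Injective fun y : PowerSeries ℂ => (y : LaurentSeries ℂ) :=
    HahnSeries.ofPowerSeries_injective
  -- The count 3 requires distinct germs, which transcendence of each over the preceding ones
  -- provides.
  have hmem : ∀ {s : Set (PowerSeries ℂ)} {x : PowerSeries ℂ},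
      Transcendental (Algebra.adjoin ℂ s) x → x ∉ s := fun hx hs =>
    hx (isAlgebraic_algebraMap (⟨_, Algebra.subset_adjoin hs⟩ : Algebra.adjoin ℂ _))
  have h1 := hmem hζ
  have h2 := hmem hftr
  simp only [Set.mem_insert_iff, Set.mem_singleton_iff, not_or] at h1 h2
  rw [Cardinal.mk_insert, Cardinal.mk_insert, Cardinal.mk_singleton]
  · norm_num
  · exact fun h => h1.2 (hinj h.symm)
  · rintro (h | h)
    exacts [h2.2.1 (hinj h), h2.2.2 (hinj h)]
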